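/- Let $(M,g)$ be a four-dimensional smooth manifold with a smooth Lorentzian metric of signature $(+,-,-,-)$ and Levi-Civita connection $\nabla$, and let $F_{ab}=-F_{ba}$ be a smooth 2-form that satisfies the source-free Maxwell equations $\nabla^aF_{ab}=0$ and $\nabla_{[a}F_{bc]}=0$. Assume that either (i) the Einstein–Maxwell equations $R_{ab}-\tfrac12Rg_{ab}+\Lambda g_{ab}=\kappa T_{ab}$ hold, where $T_{ab}=-F_{ac}F_b{}^c+\tfrac14g_{ab}F_{cd}F^{cd}$, with arbitrary real constants $\Lambda$ (cosmological constant) and $\kappa$ (coupling constant); or (ii) $(M,g)$ is an Einstein space, $R_{ab}=\Lambda g_{ab}$ for a real constant $\Lambda$ (so that $F$ is a test field). Put $A_{abc}=\nabla_aF_{bc}$, $$E_{abcd}=-A_{acf}A_{bd}{}^f-A_{adf}A_{bc}{}^f+g_{ab}A_{ecf}A^e{}_d{}^f+\tfrac12g_{cd}A_{aef}A_b{}^{ef}-\tfrac14g_{ab}g_{cd}A_{efh}A^{efh},$$ and let $H_{abcd}=\tfrac12(E_{abcd}+E_{cdab})$ be the Chevreton tensor and $H_{ab}=H^c{}_{cab}$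 its trace. Then $H_{ab}$, which is quadratic in $\nabla F$, is symmetric, trace-free and divergence-free: $$H_{ab}=H_{ba},\qquad H^a{}_a=0,\qquad \nabla^aH_{ab}=0 .$$ Moreover, the divergence of the Chevreton tensor is trace-free: the contraction of $\nabla^aH_{abcd}$ over any two of the indices $b,c,d$ vanishes. -/

import Mathlib

open scoped Manifold ContDiff

namespace Chevreton

noncomputable section

/-- The model space of a four-dimensional manifold. -/
abbrev R4 : Type := EuclideanSpace ℝ (Fin 4)

/-! ### Tensor calculus in a coordinate domain

Scalars in a coordinate domain are functions `R4 → ℝ`; only their values on the (open) domain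
matter. A covariant tensor is given by its components. -/

/-- Components of a covariant tensor of rank 2 in coordinates. -/
abbrev Comp2 : Type := Fin 4 → Fin 4 → R4 → ℝ
/-- Components of a covariant tensor of rank 3 in coordinates. -/
abbrev Comp3 : Type := Fin 4 → Fin 4 → Fin 4 → R4 → ℝ
/-- Components of a covariant tensor of rank 4 in coordinates. -/
abbrev Comp4 : Type := Fin 4 → Fin 4 → Fin 4 → Fin 4 → R4 → ℝ
/-- Components of a covariant tensor of rank 5 in coordinates. -/
abbrev Comp5 : Type := Fin 4 → Fin 4 → Fin 4 → Fin 4 → Fin 4 → R4 → ℝ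

/-- The partial derivative `∂_a f`. -/
def pd (a : Fin 4) (f : R4 → ℝ) (y : R4) : ℝ :=
  fderiv ℝ f y (EuclideanSpace.single a (1 : ℝ))

/-- The inverse metric `g^{ab}`. -/
def ginv (g : Comp2) (a b : Fin 4) (y : R4) : ℝ :=
  (Matrix.of fun i j : Fin 4 => g i j y)⁻¹ a b

/-- The Christoffel symbols `Γ^c_{ab} = ½ g^{cd} (∂_a g_{db} + ∂_b g_{da} - ∂_d g_{ab})` of the
Levi-Civita connection; the arguments are in the order `c a b`. -/
def christoffel (g : Comp2) (c a b : Fin 4) (y : R4) : ℝ :=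
  (1 / 2) * ∑ d, ginv g c d y * (pd a (g d b) y + pd b (g d a) y - pd d (g a b) y)

/-- The covariant derivative `∇_c T_{ab}`; the arguments are in the order `c a b`. -/
def nabla2 (g T : Comp2) : Comp3 := fun c a b y =>
  pd c (T a b) y
    - (∑ d, christoffel g d c a y * T d b y)
    - ∑ d, christoffel g d c b y * T a d y

/-- The covariant derivative `∇_e T_{abcd}`; the arguments are in the order `e a b c d`. -/
def nabla4 (g : Comp2) (T : Comp4) : Comp5 := fun e a b c d y =>
  pd e (T a b c d) y
    - (∑ f, christoffel g f e a y * T f b c d y)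
    - (∑ f, christoffel g f e b y * T a f c d y)
    - (∑ f, christoffel g f e c y * T a b f d y)
    - ∑ f, christoffel g f e d y * T a b c f y

/-- The Riemann tensor `R^d_{cab}`, with `(∇_a ∇_b - ∇_b ∇_a) V^d = R^d_{cab} V^c`; the arguments
are in the order `d c a b`. -/
def riemann (g : Comp2) (d c a b : Fin 4) (y : R4) : ℝ :=
  pd a (christoffel g d b c) y - pd b (christoffel g d a c) y
    + (∑ e, christoffel g d a e y * christoffel g e b c y)
    - ∑ e, christoffel g d b e y * christoffel g e a c y

/-- The Ricci tensor `R_{ab} = R^c_{acb}`. -/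
def ricci (g : Comp2) : Comp2 := fun a b y => ∑ c, riemann g c a c b y

/-- The scalar curvature `R = g^{ab} R_{ab}`. -/
def scalarCurv (g : Comp2) (y : R4) : ℝ := ∑ a, ∑ b, ginv g a b y * ricci g a b y

/-- The divergence `∇^a T_{ab}`. -/
def div2 (g T : Comp2) (b : Fin 4) (y : R4) : ℝ :=
  ∑ a, ∑ a', ginv g a a' y * nabla2 g T a' a b y

/-- The divergence `∇^a T_{abcd}`. -/
def div4 (g : Comp2) (T : Comp4) : Comp3 := fun b c d y =>
  ∑ a, ∑ a', ginv g a a' y * nabla4 g T a' a b c d y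

/-- The electromagnetic energy-momentum tensor
`T_{ab} = -F_{ac} F_b^c + ¼ g_{ab} F_{cd} F^{cd}` in signature `(+,-,-,-)`, up to a positive
constant that depends on the units. -/
def emTensor (g F : Comp2) : Comp2 := fun a b y =>
  - (∑ c, ∑ c', ginv g c c' y * F a c y * F b c' y)
    + (1 / 4) * g a b y *
      ∑ c, ∑ c', ∑ d, ∑ d', ginv g c c' y * ginv g d d' y * F c d y * F c' d' y

/-- The basic superenergy tensor of a double (1,2)-form `A_{abc} = A_{a[bc]}`:
`T_{abcd} = -A_{acf} A_{bd}^f - A_{adf} A_{bc}^f + g_{ab} A_{ecf} A^e_d^f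
  + ½ g_{cd} A_{aef} A_b^{ef} - ¼ g_{ab} g_{cd} A_{efh} A^{efh}`. -/
def superenergy (g : Comp2) (A : Comp3) : Comp4 := fun a b c d y =>
  - (∑ f, ∑ f', ginv g f f' y * A a c f y * A b d f' y)
    - (∑ f, ∑ f', ginv g f f' y * A a d f y * A b c f' y)
    + g a b y *
      (∑ e, ∑ e', ∑ f, ∑ f', ginv g e e' y * ginv g f f' y * A e c f y * A e' d f' y)
    + (1 / 2) * g c d y *
      (∑ e, ∑ e', ∑ f, ∑ f', ginv g e e' y * ginv g f f' y * A a e f y * A b e' f' y)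
    - (1 / 4) * g a b y * g c d y *
      ∑ e, ∑ e', ∑ f, ∑ f', ∑ h, ∑ h',
        ginv g e e' y * ginv g f f' y * ginv g h h' y * A e f h y * A e' f' h' y

/-- The Chevreton tensor `H_{abcd} = ½ (E_{abcd} + E_{cdab})`, where `E` is the basic superenergy
tensor of `∇_a F_{bc}`. -/
def chevreton (g F : Comp2) : Comp4 := fun a b c d y =>
  (1 / 2) * (superenergy g (nabla2 g F) a b c d y + superenergy g (nabla2 g F) c d a b y)

/-- The trace `H_{ab} = H^c_{cab}` of the Chevreton tensor. -/
def chevretonTrace (g F : Comp2) : Comp2 := fun a b y =>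
  ∑ c, ∑ c', ginv g c c' y * chevreton g F c c' a b y

/-! ### Fields on a four-dimensional manifold -/

section Manifold

variable (M : Type*) [TopologicalSpace M] [ChartedSpace R4 M]

/-- A (not necessarily smooth) field of bilinear forms on the tangent spaces of `M`. -/
abbrev BilinField : Type _ :=
  ∀ x : M, TangentSpace 𝓘(ℝ, R4) x →L[ℝ] TangentSpace 𝓘(ℝ, R4) x →L[ℝ] ℝ

variable {M}

/-- The components `T_{ab} = T(∂_a, ∂_b)` of a field of bilinear forms in a chart `φ`, as functions
of the coordinates; the coordinate vector field `∂_a` is the image of the `a`-th standard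
basis vector under the derivative of `φ⁻¹`. They are meaningful on `φ.target`. -/
def components (T : BilinField M) (φ : OpenPartialHomeomorph M R4) : Comp2 := fun a b y =>
  T (φ.symm y)
    (mfderiv 𝓘(ℝ, R4) 𝓘(ℝ, R4) φ.symm y (EuclideanSpace.single a (1 : ℝ)))
    (mfderiv 𝓘(ℝ, R4) 𝓘(ℝ, R4) φ.symm y (EuclideanSpace.single b (1 : ℝ)))

/-- The components are smooth in every chart of the maximal smooth atlas. -/
def IsSmoothField (T : BilinField M) : Prop :=
  ∀ φ ∈ IsManifold.maximalAtlas 𝓘(ℝ, R4) ∞ M, ∀ a b : Fin 4,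
    ContDiffOn ℝ ∞ (components T φ a b) φ.target

variable (M)

/-- A smooth Lorentzian metric of signature `(+,-,-,-)`. -/
structure LorentzMetric where
  /-- the bilinear forms on the tangent spaces -/
  val : BilinField M
  symm : ∀ x v w, val x v w = val x w v
  signature : ∀ x, ∃ b : Module.Basis (Fin 4) ℝ (TangentSpace 𝓘(ℝ, R4) x), ∀ i j,
    val x (b i) (b j) = if i = j then (if i = 0 then 1 else -1) else 0
  smooth : IsSmoothField val

/-- A smooth 2-form. -/
structure TwoForm where
  /-- the bilinear forms on the tangent spaces -/
  val : BilinField M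
  antisymm : ∀ x v w, val x v w = - val x w v
  smooth : IsSmoothField val

variable {M}

/-- The components `g_{ab}` of the metric in a chart. -/
abbrev LorentzMetric.comp (g : LorentzMetric M) (φ : OpenPartialHomeomorph M R4) : Comp2 :=
  components g.val φ

/-- The components `F_{ab}` of a 2-form in a chart. -/
abbrev TwoForm.comp (F : TwoForm M) (φ : OpenPartialHomeomorph M R4) : Comp2 :=
  components F.val φ

/-- The source-free Maxwell equations `∇^a F_{ab} = 0` and `∇_{[a} F_{bc]} = 0`. -/
def IsSourceFreeMaxwell (g : LorentzMetric M) (F : TwoForm M) : Prop :=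
  ∀ φ ∈ IsManifold.maximalAtlas 𝓘(ℝ, R4) ∞ M, ∀ y ∈ φ.target,
    (∀ b, div2 (g.comp φ) (F.comp φ) b y = 0) ∧
    ∀ a b c, nabla2 (g.comp φ) (F.comp φ) a b c y
      + nabla2 (g.comp φ) (F.comp φ) b c a y + nabla2 (g.comp φ) (F.comp φ) c a b y = 0

/-- The Einstein-Maxwell equations `R_{ab} - ½ R g_{ab} + Λ g_{ab} = κ T_{ab}`, with cosmological
constant `Λ` and coupling constant `κ`. -/
def IsEinsteinMaxwell (g : LorentzMetric M) (F : TwoForm M) (κ Λ : ℝ) : Prop :=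
  ∀ φ ∈ IsManifold.maximalAtlas 𝓘(ℝ, R4) ∞ M, ∀ y ∈ φ.target,
    ∀ a b, ricci (g.comp φ) a b y - (1 / 2) * scalarCurv (g.comp φ) y * g.comp φ a b y
      + Λ * g.comp φ a b y
      = κ * emTensor (g.comp φ) (F.comp φ) a b y

/-- Einstein spaces: `R_{ab} = Λ g_{ab}`. -/
def IsEinsteinSpace (g : LorentzMetric M) (Λ : ℝ) : Prop :=
  ∀ φ ∈ IsManifold.maximalAtlas 𝓘(ℝ, R4) ∞ M, ∀ y ∈ φ.target,
    ∀ a b, ricci (g.comp φ) a b y = Λ * g.comp φ a b y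

end Manifold

end

end Chevreton

/-! Write `A = ∇F`, `B = ∇A` and `S_{ab} = A_{eaf} A^e_b^f`. In dimension four the trace of `E` over
its second pair vanishes, and the trace over its first pair is `2 S_{ab} - ½ g_{ab} S^c_c`. Hence
`H_{ab} = S_{ab} - ¼ g_{ab} S^c_c` (`chevretonTrace_eq`), which is visibly symmetric and trace-free.
Maxwell's equations say that `A` is cyclic and trace-free, and then contracting one index of each
pair of `H_{abcd}` gives the same tensor (`trace23_chevreton`). Since `∇` commutes with contraction,
every trace of `∇^a H_{abcd}` equals `∇^a H_{ab}`, so all that remains is to show that this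
divergence is zero.

By the Leibniz rule the divergence is bilinear in `A` and `B`. Commuting the derivatives in `B`
leaves terms that vanish by the differentiated Maxwell equations, plus terms of the form curvature
times `F` times `A` (`frame_divergence`). These are evaluated at a point in an orthonormal frame.
The Riemann tensor splits into a Weyl part and a Kulkarni-Nomizu product of the metric with a
symmetric `P`. The Weyl part contributes nothing, by an algebraic identity in four dimensions
(`curvatureTerm_weyl`). In both cases (i) and (ii) the Ricci tensor is `Λ g_{ab} + s T_{ab}`, with
`s = κ` or `s = 0`, so `P` is a combination of `g` and `T`; as `T` is quadratic in `F`, the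
remaining expression is a polynomial in `F` and `A` which cancels (`ricciTerm_emTensor`). -/

open scoped Manifold ContDiff

namespace Chevreton

noncomputable section

/-! ### Partial derivatives of smooth functions on an open set. -/

section Calculus

variable {U : Set R4} {y : R4}

theorem pd_congr (hU : IsOpen U) {f h : R4 → ℝ} (hfh : ∀ x ∈ U, f x = h x) (hy : y ∈ U)
    (a : Fin 4) : pd a f y = pd a h y := by
  have : f =ᶠ[nhds y] h := Filter.eventually_of_mem (hU.mem_nhds hy) hfh
  simp only [pd, this.fderiv_eq]

theorem pd_const (a : Fin 4) (r : ℝ) : pd a (fun _ => r) y = 0 := by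
  simp [pd]

theorem pd_add {f h : R4 → ℝ} (hf : DifferentiableAt ℝ f y) (hh : DifferentiableAt ℝ h y)
    (a : Fin 4) : pd a (fun x => f x + h x) y = pd a f y + pd a h y := by
  simp [pd, fderiv_fun_add hf hh]

theorem pd_sub {f h : R4 → ℝ} (hf : DifferentiableAt ℝ f y) (hh : DifferentiableAt ℝ h y)
    (a : Fin 4) : pd a (fun x => f x - h x) y = pd a f y - pd a h y := by
  simp [pd, fderiv_fun_sub hf hh]

theorem pd_neg {f : R4 → ℝ} (a : Fin 4) : pd a (fun x => - f x) y = - pd a f y := by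
  simp [pd, fderiv_fun_neg]

theorem pd_mul {f h : R4 → ℝ} (hf : DifferentiableAt ℝ f y) (hh : DifferentiableAt ℝ h y)
    (a : Fin 4) : pd a (fun x => f x * h x) y = pd a f y * h y + f y * pd a h y := by
  simp only [pd, fderiv_fun_mul hf hh, _root_.add_apply,
    _root_.smul_apply, smul_eq_mul]
  ring

theorem pd_sum {ι : Type*} [Fintype ι] {f : ι → R4 → ℝ}
    (hf : ∀ i, DifferentiableAt ℝ (f i) y) (a : Fin 4) :
    pd a (fun x => ∑ i, f i x) y = ∑ i, pd a (f i) y := by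
  simp [pd, fderiv_fun_sum (fun i _ => hf i)]

theorem smooth_pd (hU : IsOpen U) {f : R4 → ℝ} (hf : ContDiffOn ℝ ∞ f U) (a : Fin 4) :
    ContDiffOn ℝ ∞ (pd a f) U :=
  (hf.fderiv_of_isOpen hU (by simp)).clm_apply contDiffOn_const

theorem smooth_differentiableAt (hU : IsOpen U) {f : R4 → ℝ} (hf : ContDiffOn ℝ ∞ f U)
    (hy : y ∈ U) : DifferentiableAt ℝ f y :=
  (hf.contDiffAt (hU.mem_nhds hy)).differentiableAt (by simp)

theorem pd_comm (hU : IsOpen U) {f : R4 → ℝ} (hf : ContDiffOn ℝ ∞ f U) (hy : y ∈ U)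
    (a b : Fin 4) : pd a (pd b f) y = pd b (pd a f) y := by
  have hs : IsSymmSndFDerivAt ℝ f y :=
    (hf.contDiffAt (hU.mem_nhds hy)).isSymmSndFDerivAt (by simpa using ENat.LEInfty.out)
  have hd : DifferentiableAt ℝ (fderiv ℝ f) y :=
    ((hf.fderiv_of_isOpen hU (m := ∞) (by simp)).contDiffAt
      (hU.mem_nhds hy)).differentiableAt (by simp)
  have key : ∀ c d : Fin 4, pd c (pd d f) y =
      fderiv ℝ (fderiv ℝ f) y (EuclideanSpace.single c 1) (EuclideanSpace.single d 1) := by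
    intro c d
    have : pd d f = fun x => fderiv ℝ f x (EuclideanSpace.single d (1 : ℝ)) := rfl
    rw [pd, this, fderiv_clm_apply hd (differentiableAt_const _)]
    simp
  rw [key, key, hs]

end Calculus

/-! ### Leibniz rule for matrix products of functions. -/

section MatrixCalculus

variable {U : Set R4} {y : R4} {m n k l : Type*}

/-- The value at a point of an array of functions, as a matrix. -/
def valueMatrix (X : m → n → R4 → ℝ) (y : R4) : Matrix m n ℝ := Matrix.of fun i j => X i j y

/-- The partial derivatives at a point of an array of functions, as a matrix. -/
def pdMatrix (c : Fin 4) (X : m → n → R4 → ℝ) (y : R4) : Matrix m n ℝ :=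
  Matrix.of fun i j => pd c (X i j) y

/-- The pointwise matrix product of arrays of functions. -/
def mulArray [Fintype n] (X : m → n → R4 → ℝ) (Y : n → k → R4 → ℝ) : m → k → R4 → ℝ :=
  fun i j x => ∑ r, X i r x * Y r j x

theorem valueMatrix_mulArray [Fintype n] (X : m → n → R4 → ℝ) (Y : n → k → R4 → ℝ) (y : R4) :
    valueMatrix (mulArray X Y) y = valueMatrix X y * valueMatrix Y y := by
  ext i j; simp [valueMatrix, mulArray, Matrix.mul_apply]

theorem pdMatrix_mulArray [Fintype n] {X : m → n → R4 → ℝ} {Y : n → k → R4 → ℝ}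
    (hX : ∀ i j, DifferentiableAt ℝ (X i j) y) (hY : ∀ i j, DifferentiableAt ℝ (Y i j) y)
    (c : Fin 4) : pdMatrix c (mulArray X Y) y =
      pdMatrix c X y * valueMatrix Y y + valueMatrix X y * pdMatrix c Y y := by
  ext i j
  simp only [pdMatrix, valueMatrix, Matrix.of_apply, Matrix.add_apply, Matrix.mul_apply]
  rw [← Finset.sum_add_distrib]
  refine (pd_sum (fun r => (hX i r).fun_mul (hY r j)) c).trans ?_
  exact Finset.sum_congr rfl fun r _ => pd_mul (hX i r) (hY r j) c

theorem pdMatrix_congr (hU : IsOpen U) {X Y : m → n → R4 → ℝ}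
    (h : ∀ x ∈ U, valueMatrix X x = valueMatrix Y x) (hy : y ∈ U) (c : Fin 4) :
    pdMatrix c X y = pdMatrix c Y y := by
  ext i j
  exact pd_congr hU (fun x hx => congrFun (congrFun (h x hx) i) j) hy c

end MatrixCalculus

/-! ### The Levi-Civita connection: metric compatibility and contraction. -/

section LeviCivita

/-- The components of a smooth nondegenerate symmetric bilinear form on an open set. -/
structure IsMetricOn (g : Comp2) (U : Set R4) : Prop where
  isOpen : IsOpen U
  smooth : ∀ a b, ContDiffOn ℝ ∞ (g a b) U
  symm : ∀ x ∈ U, ∀ a b, g a b x = g b a x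
  det_ne_zero : ∀ x ∈ U, (valueMatrix g x).det ≠ 0

variable {g : Comp2} {U : Set R4} {y : R4}

/-- The matrix `(Γ_c)^d_a` of the Levi-Civita connection in the direction `c`. -/
def connMatrix (g : Comp2) (c : Fin 4) (y : R4) : Matrix (Fin 4) (Fin 4) ℝ :=
  valueMatrix (fun d a => christoffel g d c a) y

theorem valueMatrix_ginv (g : Comp2) (y : R4) :
    valueMatrix (ginv g) y = (valueMatrix g y)⁻¹ := by
  ext i j; rfl

/-- In this form index manipulations with the connection become noncommutative matrix algebra. -/
theorem nabla2_matrix (g T : Comp2) (c : Fin 4) (y : R4) :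
    Matrix.of (fun a b => nabla2 g T c a b y) =
      pdMatrix c T y - (connMatrix g c y).transpose * valueMatrix T y
        - valueMatrix T y * connMatrix g c y := by
  ext a b
  simp [nabla2, pdMatrix, connMatrix, valueMatrix, Matrix.mul_apply, mul_comm]

namespace IsMetricOn

variable (hg : IsMetricOn g U)
include hg

theorem isUnit_det (hy : y ∈ U) : IsUnit (valueMatrix g y).det :=
  isUnit_iff_ne_zero.mpr (hg.det_ne_zero y hy)

theorem transpose_valueMatrix (hy : y ∈ U) :
    (valueMatrix g y).transpose = valueMatrix g y := by
  ext i j; exact hg.symm y hy j i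

theorem ginv_symm (hy : y ∈ U) (a b : Fin 4) : ginv g a b y = ginv g b a y := by
  have h : (valueMatrix (ginv g) y).transpose = valueMatrix (ginv g) y := by
    rw [valueMatrix_ginv, Matrix.transpose_nonsing_inv, hg.transpose_valueMatrix hy]
  exact congrFun (congrFun h b) a

theorem ginv_mul (hy : y ∈ U) : valueMatrix (ginv g) y * valueMatrix g y = 1 := by
  rw [valueMatrix_ginv, Matrix.nonsing_inv_mul _ (hg.isUnit_det hy)]

theorem mul_ginv (hy : y ∈ U) : valueMatrix g y * valueMatrix (ginv g) y = 1 := by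
  rw [valueMatrix_ginv, Matrix.mul_nonsing_inv _ (hg.isUnit_det hy)]

theorem smooth_ginv (a b : Fin 4) : ContDiffOn ℝ ∞ (ginv g a b) U := by
  have hdet : ∀ X : Comp2, (∀ a b, ContDiffOn ℝ ∞ (X a b) U) →
      ContDiffOn ℝ ∞ (fun x => (valueMatrix X x).det) U := by
    intro X hX
    simp only [Matrix.det_apply]
    refine ContDiffOn.sum fun σ _ => ContDiffOn.const_smul _ ?_
    exact contDiffOn_prod fun i _ => hX (σ i) i
  have hadj : ContDiffOn ℝ ∞ (fun x => (valueMatrix g x).adjugate a b) U := by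
    simp only [Matrix.adjugate_apply]
    -- An adjugate entry is the determinant of the matrix with one row replaced by a basis vector;
    -- `X` is that matrix as an array of smooth functions, so `hdet` covers it.
    let X : Comp2 := fun i j x => if i = b then (Pi.single a (1 : ℝ) : Fin 4 → ℝ) j else g i j x
    have hX : ∀ i j, ContDiffOn ℝ ∞ (X i j) U := by
      intro i j
      by_cases h : i = b
      · simp only [X, h, if_true]; exact contDiffOn_const
      · simp only [X, h, if_false]; exact hg.smooth i j
    have : ∀ x, (valueMatrix g x).updateRow b (Pi.single a 1) = valueMatrix X x := by
      intro x; ext i j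
      by_cases h : i = b <;> simp [valueMatrix, X, h, Matrix.updateRow_apply]
    simpa only [this] using hdet X hX
  have h := ((hdet g hg.smooth).inv fun x hx => hg.det_ne_zero x hx).mul hadj
  refine h.congr fun x _ => ?_
  change (valueMatrix g x)⁻¹ a b = _
  rw [Matrix.inv_def, Ring.inverse_eq_inv']
  rfl

theorem smooth_christoffel (c a b : Fin 4) : ContDiffOn ℝ ∞ (christoffel g c a b) U := by
  refine contDiffOn_const.mul (ContDiffOn.sum fun d _ => (hg.smooth_ginv c d).mul ?_)
  exact ((smooth_pd hg.isOpen (hg.smooth d b) a).add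
    (smooth_pd hg.isOpen (hg.smooth d a) b)).sub (smooth_pd hg.isOpen (hg.smooth a b) d)

theorem pd_symm (hy : y ∈ U) (c a b : Fin 4) : pd c (g a b) y = pd c (g b a) y :=
  pd_congr hg.isOpen (fun x hx => hg.symm x hx a b) hy c

theorem christoffel_symm (hy : y ∈ U) (c a b : Fin 4) :
    christoffel g c a b y = christoffel g c b a y := by
  simp only [christoffel]
  congr 1
  refine Finset.sum_congr rfl fun d _ => ?_
  rw [hg.pd_symm hy d a b]; ring

theorem lower_christoffel (hy : y ∈ U) (e a b : Fin 4) :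
    ∑ c, g e c y * christoffel g c a b y =
      (1 / 2) * (pd a (g e b) y + pd b (g e a) y - pd e (g a b) y) := by
  let v : Fin 4 → ℝ := fun d => (1 / 2) * (pd a (g d b) y + pd b (g d a) y - pd d (g a b) y)
  have h : (valueMatrix g y).mulVec ((valueMatrix (ginv g) y).mulVec v) = v := by
    rw [Matrix.mulVec_mulVec, hg.mul_ginv hy, Matrix.one_mulVec]
  refine Eq.trans ?_ (congrFun h e)
  simp only [Matrix.mulVec, dotProduct, valueMatrix, Matrix.of_apply, christoffel]
  refine Finset.sum_congr rfl fun c _ => ?_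
  rw [Finset.mul_sum]
  congr 1
  refine Finset.sum_congr rfl fun d _ => ?_
  ring

theorem nabla_metric (hy : y ∈ U) (c a b : Fin 4) : nabla2 g g c a b y = 0 := by
  have h1 : ∑ d, christoffel g d c a y * g d b y = ∑ d, g b d y * christoffel g d c a y :=
    Finset.sum_congr rfl fun d _ => by rw [hg.symm y hy d b, mul_comm]
  have h2 : ∑ d, christoffel g d c b y * g a d y = ∑ d, g a d y * christoffel g d c b y :=
    Finset.sum_congr rfl fun d _ => mul_comm _ _
  rw [nabla2, h1, h2, hg.lower_christoffel hy, hg.lower_christoffel hy, hg.pd_symm hy c b a,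
    hg.pd_symm hy b c a, hg.pd_symm hy a b c, hg.pd_symm hy b a c]
  ring

theorem pdMatrix_metric (hy : y ∈ U) (c : Fin 4) : pdMatrix c g y =
    (connMatrix g c y).transpose * valueMatrix g y + valueMatrix g y * connMatrix g c y := by
  have h := nabla2_matrix g g c y
  have h0 : Matrix.of (fun a b => nabla2 g g c a b y) = 0 := by
    ext a b; exact hg.nabla_metric hy c a b
  rw [h0, sub_sub, eq_comm, sub_eq_zero] at h
  exact h

theorem pdMatrix_ginv (hy : y ∈ U) (c : Fin 4) : pdMatrix c (ginv g) y =
    - (connMatrix g c y * valueMatrix (ginv g) y)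
      - valueMatrix (ginv g) y * (connMatrix g c y).transpose := by
  have hd : ∀ a b, DifferentiableAt ℝ (g a b) y := fun a b =>
    smooth_differentiableAt hg.isOpen (hg.smooth a b) hy
  have hd' : ∀ a b, DifferentiableAt ℝ (ginv g a b) y := fun a b =>
    smooth_differentiableAt hg.isOpen (hg.smooth_ginv a b) hy
  have h := pdMatrix_mulArray hd' hd c
  have h0 : pdMatrix c (mulArray (ginv g) g) y = 0 := by
    rw [pdMatrix_congr (Y := fun i j _ => (1 : Matrix (Fin 4) (Fin 4) ℝ) i j) hg.isOpen
      (fun x hx => by rw [valueMatrix_mulArray, hg.ginv_mul hx]; rfl) hy]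
    ext i j; exact pd_const c _
  rw [h0, hg.pdMatrix_metric hy] at h
  -- The derivative of `g⁻¹ g = 1` is multiplied by `g⁻¹` on the right to isolate `∂ g⁻¹`.
  have h2 := congrArg (· * valueMatrix (ginv g) y) h
  simp only [zero_mul, add_mul, mul_add, mul_assoc, hg.mul_ginv hy, mul_one] at h2
  rw [← mul_assoc (valueMatrix (ginv g) y) (valueMatrix g y), hg.ginv_mul hy, one_mul] at h2
  rw [← sub_eq_zero, h2]
  abel

/-- Contraction with the metric commutes with the covariant derivative. -/
theorem contract_nabla2 (hy : y ∈ U) {T : Comp2} (hT : ∀ a b, DifferentiableAt ℝ (T a b) y)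
    (c : Fin 4) : ∑ a, ∑ b, ginv g a b y * nabla2 g T c a b y =
      pd c (fun x => ∑ a, ∑ b, ginv g a b x * T a b x) y := by
  have hd' : ∀ a b, DifferentiableAt ℝ (ginv g a b) y := fun a b =>
    smooth_differentiableAt hg.isOpen (hg.smooth_ginv a b) hy
  have htr : ∀ X Y : Matrix (Fin 4) (Fin 4) ℝ,
      ∑ a, ∑ b, X a b * Y a b = (X * Y.transpose).trace := by
    intro X Y
    simp [Matrix.trace, Matrix.mul_apply]
  rw [pd_sum fun a => DifferentiableAt.fun_sum fun b _ => (hd' a b).fun_mul (hT a b)]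
  have h1 : ∀ a, pd c (fun x => ∑ b, ginv g a b x * T a b x) y =
      ∑ b, pdMatrix c (ginv g) y a b * valueMatrix T y a b
        + ∑ b, valueMatrix (ginv g) y a b * pdMatrix c T y a b := by
    intro a
    rw [pd_sum fun b => (hd' a b).fun_mul (hT a b), ← Finset.sum_add_distrib]
    exact Finset.sum_congr rfl fun b _ => pd_mul (hd' a b) (hT a b) c
  have h2 : ∑ a, ∑ b, ginv g a b y * nabla2 g T c a b y =
      ∑ a, ∑ b, valueMatrix (ginv g) y a b *
        (Matrix.of fun a b => nabla2 g T c a b y) a b := rfl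
  simp only [h1, Finset.sum_add_distrib]
  rw [h2, htr, htr, htr, nabla2_matrix, hg.pdMatrix_ginv hy]
  simp only [Matrix.transpose_sub, Matrix.transpose_mul, Matrix.transpose_transpose, mul_sub,
    sub_mul, neg_mul, Matrix.trace_sub, Matrix.trace_neg, mul_assoc]
  -- Cyclicity of the trace matches the connection term of `∂ g⁻¹` with that of `∇T`.
  rw [Matrix.trace_mul_comm (connMatrix g c y), mul_assoc]
  ring

end IsMetricOn

end LeviCivita

/-! ### The Riemann tensor: Ricci identity, symmetries, differentiated field equations. -/

section Curvature

variable {g : Comp2} {U : Set R4} {y : R4}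

/-- The covariant derivative `∇_c A_{eab}`; the arguments are in the order `c e a b`. -/
def nabla3 (g : Comp2) (A : Comp3) : Comp4 := fun c e a b y =>
  pd c (A e a b) y
    - (∑ d, christoffel g d c e y * A d a b y)
    - (∑ d, christoffel g d c a y * A e d b y)
    - ∑ d, christoffel g d c b y * A e a d y

/-- The Riemann tensor `R_{dcab}` with all indices lowered. -/
def lowerRiemann (g : Comp2) (d c a b : Fin 4) (y : R4) : ℝ :=
  ∑ e, g d e y * riemann g e c a b y

/-- The curvature endomorphism `(R_{ab})^d_c`. -/
def curvMatrix (g : Comp2) (a b : Fin 4) (y : R4) : Matrix (Fin 4) (Fin 4) ℝ :=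
  Matrix.of fun d c => riemann g d c a b y

theorem curvMatrix_eq (g : Comp2) (a b : Fin 4) (y : R4) : curvMatrix g a b y =
    pdMatrix a (fun d c => christoffel g d b c) y - pdMatrix b (fun d c => christoffel g d a c) y
      + connMatrix g a y * connMatrix g b y - connMatrix g b y * connMatrix g a y := by
  ext d c
  simp [curvMatrix, riemann, pdMatrix, connMatrix, valueMatrix, Matrix.mul_apply]

theorem riemann_antisymm (g : Comp2) (d c a b : Fin 4) (y : R4) :
    riemann g d c a b y = - riemann g d c b a y := by
  simp only [riemann]; ring

theorem lowerRiemann_antisymm_right (g : Comp2) (d c a b : Fin 4) (y : R4) :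
    lowerRiemann g d c a b y = - lowerRiemann g d c b a y := by
  simp only [lowerRiemann, riemann_antisymm g _ c a b, mul_neg, Finset.sum_neg_distrib]

theorem nabla2_congr (g : Comp2) {T T' : Comp2} (hU : IsOpen U)
    (h : ∀ x ∈ U, ∀ a b, T a b x = T' a b x) (hy : y ∈ U) (c a b : Fin 4) :
    nabla2 g T c a b y = nabla2 g T' c a b y := by
  simp only [nabla2, pd_congr hU (fun x hx => h x hx a b) hy, h y hy]

theorem nabla2_antisymm {F : Comp2} (hU : IsOpen U)
    (h : ∀ x ∈ U, ∀ a b, F a b x = - F b a x) (hy : y ∈ U)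
    (c a b : Fin 4) :
    nabla2 g F c a b y = - nabla2 g F c b a y := by
  have h0 : pd c (F a b) y = - pd c (F b a) y := by
    rw [pd_congr hU (fun x hx => h x hx a b) hy, pd_neg]
  simp only [nabla2, h0, h y hy _ b, h y hy a _, mul_neg, Finset.sum_neg_distrib]
  ring

theorem nabla3_antisymm {A : Comp3} (hU : IsOpen U)
    (h : ∀ x ∈ U, ∀ e a b, A e a b x = - A e b a x) (hy : y ∈ U)
    (c e a b : Fin 4) :
    nabla3 g A c e a b y = - nabla3 g A c e b a y := by
  have h0 : pd c (A e a b) y = - pd c (A e b a) y := by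
    rw [pd_congr hU (fun x hx => h x hx e a b) hy, pd_neg]
  simp only [nabla3, h0, h y hy _ a b, h y hy e _ b, h y hy e a _, mul_neg,
    Finset.sum_neg_distrib]
  ring

namespace IsMetricOn

variable (hg : IsMetricOn g U)
include hg

theorem smooth_nabla2 {T : Comp2} (hT : ∀ a b, ContDiffOn ℝ ∞ (T a b) U) (c a b : Fin 4) :
    ContDiffOn ℝ ∞ (nabla2 g T c a b) U := by
  refine ((smooth_pd hg.isOpen (hT a b) c).sub ?_).sub ?_
  · exact ContDiffOn.sum fun d _ => (hg.smooth_christoffel d c a).mul (hT d b)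
  · exact ContDiffOn.sum fun d _ => (hg.smooth_christoffel d c b).mul (hT a d)

/-- The Ricci identity for covariant tensors of rank 2. -/
theorem ricci_identity {T : Comp2} (hT : ∀ a b, ContDiffOn ℝ ∞ (T a b) U) (hy : y ∈ U)
    (c e a b : Fin 4) :
    nabla3 g (nabla2 g T) c e a b y - nabla3 g (nabla2 g T) e c a b y =
      - (∑ d, riemann g d a c e y * T d b y) - ∑ d, riemann g d b c e y * T a d y := by
  have hU := hg.isOpen
  have hdT : ∀ a b, DifferentiableAt ℝ (T a b) y := fun a b =>
    smooth_differentiableAt hU (hT a b) hy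
  have hdpd : ∀ c a b, DifferentiableAt ℝ (pd c (T a b)) y := fun c a b =>
    smooth_differentiableAt hU (smooth_pd hU (hT a b) c) hy
  have hdΓ : ∀ d c a, DifferentiableAt ℝ (christoffel g d c a) y := fun d c a =>
    smooth_differentiableAt hU (hg.smooth_christoffel d c a) hy
  have hpd : ∀ c e, pdMatrix c (nabla2 g T e) y = pdMatrix c (fun a b => pd e (T a b)) y
      - (pdMatrix c (fun d a => christoffel g d e a) y).transpose * valueMatrix T y
      - (connMatrix g e y).transpose * pdMatrix c T y
      - pdMatrix c T y * connMatrix g e y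
      - valueMatrix T y * pdMatrix c (fun d a => christoffel g d e a) y := by
    intro c e
    have h1 := pdMatrix_mulArray (X := fun a d => christoffel g d e a) (Y := T)
      (fun i j => hdΓ j e i) hdT c
    have h2 := pdMatrix_mulArray (X := T) (Y := fun d a => christoffel g d e a)
      hdT (fun i j => hdΓ i e j) c
    have h3 : pdMatrix c (nabla2 g T e) y = pdMatrix c (fun a b => pd e (T a b)) y
        - pdMatrix c (mulArray (fun a d => christoffel g d e a) T) y
        - pdMatrix c (mulArray T fun d a => christoffel g d e a) y := by
      ext a b
      have e1 : DifferentiableAt ℝ (fun x => ∑ d, christoffel g d e a x * T d b x) y :=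
        DifferentiableAt.fun_sum fun d _ => (hdΓ d e a).fun_mul (hdT d b)
      have e2 : DifferentiableAt ℝ (fun x => ∑ d, T a d x * christoffel g d e b x) y :=
        DifferentiableAt.fun_sum fun d _ => (hdT a d).fun_mul (hdΓ d e b)
      have e3 : nabla2 g T e a b = fun x => (pd e (T a b) x
          - ∑ d, christoffel g d e a x * T d b x) - ∑ d, T a d x * christoffel g d e b x := by
        funext x
        simp only [nabla2, mul_comm (T a _ x)]
      simp only [pdMatrix, Matrix.of_apply, Matrix.sub_apply, e3]
      rw [pd_sub ((hdpd e a b).fun_sub e1) e2, pd_sub (hdpd e a b) e1]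
      rfl
    rw [h3, h1, h2]
    have t1 : pdMatrix c (fun a d => christoffel g d e a) y =
      (pdMatrix c (fun d a => christoffel g d e a) y).transpose := rfl
    have t2 : valueMatrix (fun a d => christoffel g d e a) y = (connMatrix g e y).transpose := rfl
    have t3 : valueMatrix (fun d a => christoffel g d e a) y = connMatrix g e y := rfl
    rw [t1, t2, t3]
    abel
  have hcomm : ∀ c e, pdMatrix c (fun a b => pd e (T a b)) y =
      pdMatrix e (fun a b => pd c (T a b)) y := by
    intro c e; ext a b; exact pd_comm hU (hT a b) hy c e
  have hn : ∀ c e, Matrix.of (fun a b => nabla3 g (nabla2 g T) c e a b y) =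
      pdMatrix c (nabla2 g T e) y
        - Matrix.of (fun a b => ∑ d, christoffel g d c e y * nabla2 g T d a b y)
        - (connMatrix g c y).transpose * Matrix.of (fun a b => nabla2 g T e a b y)
        - Matrix.of (fun a b => nabla2 g T e a b y) * connMatrix g c y := by
    intro c e; ext a b
    simp [nabla3, pdMatrix, connMatrix, valueMatrix, Matrix.mul_apply, mul_comm]
  -- Absence of torsion: the connection terms on the two derivative indices agree and drop out of
  -- the commutator.
  have hΓ : Matrix.of (fun a b => ∑ d, christoffel g d c e y * nabla2 g T d a b y) =
      Matrix.of (fun a b => ∑ d, christoffel g d e c y * nabla2 g T d a b y) := by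
    simp only [hg.christoffel_symm hy _ c e]
  -- Second derivatives of `T` cancel by `hcomm` and first derivatives cancel in pairs; the
  -- surviving `∂Γ` and `ΓΓ` terms assemble into the curvature matrix.
  have key : Matrix.of (fun a b => nabla3 g (nabla2 g T) c e a b y)
      - Matrix.of (fun a b => nabla3 g (nabla2 g T) e c a b y) =
      - ((curvMatrix g c e y).transpose * valueMatrix T y)
      - valueMatrix T y * curvMatrix g c e y := by
    rw [hn, hn, hΓ, hpd, hpd, hcomm e c, nabla2_matrix, nabla2_matrix, curvMatrix_eq]
    simp only [Matrix.transpose_sub, Matrix.transpose_add, Matrix.transpose_mul]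
    noncomm_ring
  have := congrFun (congrFun key a) b
  simp only [Matrix.sub_apply, Matrix.neg_apply, Matrix.of_apply, Matrix.mul_apply,
    Matrix.transpose_apply, curvMatrix, valueMatrix] at this
  rw [this]
  simp only [mul_comm (T a _ y)]

/-- The Ricci identity applied to the metric itself: its left side vanishes because `∇g = 0` on the
whole open set. -/
theorem lowerRiemann_antisymm_left (hy : y ∈ U) (d c a b : Fin 4) :
    lowerRiemann g d c a b y = - lowerRiemann g c d a b y := by
  have h0 : ∀ c e a b, nabla3 g (nabla2 g g) c e a b y = 0 := by
    intro c e a b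
    have : pd c (nabla2 g g e a b) y = 0 := by
      rw [pd_congr hg.isOpen (fun x hx => hg.nabla_metric hx e a b) hy, pd_const]
    simp [nabla3, this, hg.nabla_metric hy]
  have h := hg.ricci_identity hg.smooth hy a b d c
  rw [h0, h0] at h
  simp only [lowerRiemann]
  have e : ∑ e, g c e y * riemann g e d a b y = ∑ e, riemann g e d a b y * g e c y :=
    Finset.sum_congr rfl fun e _ => by rw [hg.symm y hy c e, mul_comm]
  rw [e]
  simp only [mul_comm (g d _ y)]
  linarith

/-- The first Bianchi identity, a consequence of the symmetry of the Christoffel symbols alone. -/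
theorem riemann_cyclic (hy : y ∈ U) (d a b c : Fin 4) :
    riemann g d a b c y + riemann g d b c a y + riemann g d c a b y = 0 := by
  have h : ∀ a b c, pd a (christoffel g d b c) y = pd a (christoffel g d c b) y := fun a b c =>
    pd_congr hg.isOpen (fun x hx => hg.christoffel_symm hx d b c) hy a
  simp only [riemann, h b c a, h a c b, h c b a, hg.christoffel_symm hy _ c a,
    hg.christoffel_symm hy _ c b, hg.christoffel_symm hy _ b a]
  ring

theorem lowerRiemann_cyclic (hy : y ∈ U) (d a b c : Fin 4) :
    lowerRiemann g d a b c y + lowerRiemann g d b c a y + lowerRiemann g d c a b y = 0 := by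
  simp only [lowerRiemann, ← Finset.sum_add_distrib, ← mul_add, hg.riemann_cyclic hy, mul_zero,
    Finset.sum_const_zero]

theorem riemann_eq (hy : y ∈ U) (d c a b : Fin 4) :
    riemann g d c a b y = ∑ e, ginv g d e y * lowerRiemann g e c a b y := by
  let v : Fin 4 → ℝ := fun e => riemann g e c a b y
  have h : (valueMatrix (ginv g) y).mulVec ((valueMatrix g y).mulVec v) = v := by
    rw [Matrix.mulVec_mulVec, hg.ginv_mul hy, Matrix.one_mulVec]
  exact (congrFun h d).symm

theorem ricci_eq (hy : y ∈ U) (a b : Fin 4) :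
    ricci g a b y = ∑ c, ∑ d, ginv g c d y * lowerRiemann g d a c b y :=
  Finset.sum_congr rfl fun c _ => hg.riemann_eq hy c a c b

/-- This and `nabla3_traceFree` carry the two Maxwell equations over to `∇∇F`; both need the
equations on an open set, not only at the point. -/
theorem nabla3_cyclic {A : Comp3} (hA : ∀ e a b, ContDiffOn ℝ ∞ (A e a b) U)
    (h : ∀ x ∈ U, ∀ e a b, A e a b x + A a b e x + A b e a x = 0) (hy : y ∈ U)
    (c e a b : Fin 4) :
    nabla3 g A c e a b y + nabla3 g A c a b e y + nabla3 g A c b e a y = 0 := by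
  have hd : ∀ e a b, DifferentiableAt ℝ (A e a b) y := fun e a b =>
    smooth_differentiableAt hg.isOpen (hA e a b) hy
  have h0 : pd c (A e a b) y + pd c (A a b e) y + pd c (A b e a) y = 0 := by
    rw [← pd_add (hd e a b) (hd a b e), ← pd_add ((hd e a b).fun_add (hd a b e)) (hd b e a),
      pd_congr hg.isOpen (fun x hx => h x hx e a b) hy, pd_const]
  have hs : ∀ i a b, ∑ d, christoffel g d c i y * A d a b y
      + ∑ d, christoffel g d c i y * A a b d y + ∑ d, christoffel g d c i y * A b d a y = 0 := by
    intro i a b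
    simp only [← Finset.sum_add_distrib, ← mul_add, h y hy, mul_zero, Finset.sum_const_zero]
  simp only [nabla3]
  linear_combination h0 - hs e a b - hs a b e - hs b e a

theorem nabla3_traceFree {A : Comp3} (hA : ∀ e a b, ContDiffOn ℝ ∞ (A e a b) U)
    (h : ∀ x ∈ U, ∀ b, ∑ e, ∑ a, ginv g e a x * A e a b x = 0) (hy : y ∈ U)
    (c b : Fin 4) : ∑ e, ∑ a, ginv g e a y * nabla3 g A c e a b y = 0 := by
  have h1 : ∀ e a, nabla3 g A c e a b y = nabla2 g (fun e a => A e a b) c e a y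
      - ∑ d, christoffel g d c b y * A e a d y := fun e a => rfl
  simp only [h1, mul_sub, Finset.sum_sub_distrib]
  rw [hg.contract_nabla2 hy fun e a => smooth_differentiableAt hg.isOpen (hA e a b) hy,
    pd_congr hg.isOpen (fun x hx => h x hx b) hy, pd_const, zero_sub, neg_eq_zero]
  simp only [Finset.mul_sum]
  rw [Finset.sum_congr rfl fun e _ => Finset.sum_comm, Finset.sum_comm]
  refine Finset.sum_eq_zero fun d _ => ?_
  rw [← mul_zero (christoffel g d c b y), ← h y hy d, Finset.mul_sum]
  refine Finset.sum_congr rfl fun e _ => ?_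
  rw [Finset.mul_sum]
  exact Finset.sum_congr rfl fun a _ => by ring

end IsMetricOn

end Curvature

/-! ### The Leibniz rule for the quadratic contraction of `A` with itself. -/

section Contraction

variable {g : Comp2} {U : Set R4} {y : R4}

/-- The contraction `A_{eaf} A^e_b^f`. -/
def contractOuter (g : Comp2) (A : Comp3) : Comp2 := fun a b y =>
  ∑ e, ∑ e', ∑ f, ∑ f', ginv g e e' y * ginv g f f' y * A e a f y * A e' b f' y

namespace IsMetricOn

variable (hg : IsMetricOn g U)
include hg

open scoped Kronecker in
/-- The Leibniz rule for `A_{eaf} A^e_b^f`. -/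
theorem nabla2_contractOuter {A : Comp3} (hA : ∀ e a b, ContDiffOn ℝ ∞ (A e a b) U) (hy : y ∈ U)
    (c a b : Fin 4) : nabla2 g (contractOuter g A) c a b y =
      ∑ e, ∑ e', ∑ f, ∑ f', ginv g e e' y * ginv g f f' y *
        (nabla3 g A c e a f y * A e' b f' y + A e a f y * nabla3 g A c e' b f' y) := by
  have hd : ∀ e a b, DifferentiableAt ℝ (A e a b) y := fun e a b =>
    smooth_differentiableAt hg.isOpen (hA e a b) hy
  have hd' : ∀ a b, DifferentiableAt ℝ (ginv g a b) y := fun a b =>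
    smooth_differentiableAt hg.isOpen (hg.smooth_ginv a b) hy
  -- With the contracted indices `(e, f)` merged into one, the contraction is the matrix product `Xᵀ
  -- G X`, where `G = g⁻¹ ⊗ g⁻¹`; `Γ'` is the induced connection on index pairs, and its
  -- contributions from `G` and `X` cancel.
  let X : Fin 4 × Fin 4 → Fin 4 → R4 → ℝ := fun p a => A p.1 a p.2
  let G : Fin 4 × Fin 4 → Fin 4 × Fin 4 → R4 → ℝ := fun p q x => ginv g p.1 q.1 x * ginv g p.2 q.2 x
  let Γ := connMatrix g c y
  let Γ' : Matrix (Fin 4 × Fin 4) (Fin 4 × Fin 4) ℝ := Γ ⊗ₖ 1 + 1 ⊗ₖ Γ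
  let D : Matrix (Fin 4 × Fin 4) (Fin 4) ℝ := Matrix.of fun p a => nabla3 g A c p.1 a p.2 y
  have hX : ∀ p a, DifferentiableAt ℝ (X p a) y := fun p a => hd _ _ _
  have hG : ∀ p q, DifferentiableAt ℝ (G p q) y := fun p q => (hd' _ _).fun_mul (hd' _ _)
  have hS : contractOuter g A = mulArray (fun a p => X p a) (mulArray G X) := by
    funext a b x
    simp only [contractOuter, mulArray, X, G, Fintype.sum_prod_type, Finset.mul_sum]
    refine Finset.sum_congr rfl fun e _ => ?_
    rw [Finset.sum_comm]
    refine Finset.sum_congr rfl fun f _ => Finset.sum_congr rfl fun e' _ =>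
      Finset.sum_congr rfl fun f' _ => by ring
  have hpG : pdMatrix c G y = - (Γ' * valueMatrix G y) - valueMatrix G y * Γ'.transpose := by
    have h1 : pdMatrix c G y = pdMatrix c (ginv g) y ⊗ₖ valueMatrix (ginv g) y
        + valueMatrix (ginv g) y ⊗ₖ pdMatrix c (ginv g) y := by
      ext p q
      exact pd_mul (hd' _ _) (hd' _ _) c
    have h2 : valueMatrix G y = valueMatrix (ginv g) y ⊗ₖ valueMatrix (ginv g) y := rfl
    have h3 : Γ'.transpose = Γ.transpose ⊗ₖ 1 + 1 ⊗ₖ Γ.transpose := by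
      ext ⟨i, j⟩ ⟨k, l⟩
      simp [Γ', Matrix.one_apply, eq_comm]
    rw [h1, h2, h3, hg.pdMatrix_ginv hy]
    simp only [Γ', add_mul, mul_add, ← Matrix.mul_kronecker_mul, one_mul, mul_one,
      sub_eq_add_neg, Matrix.add_kronecker, Matrix.kronecker_add, ← neg_one_smul ℝ (_ * _),
      Matrix.smul_kronecker, Matrix.kronecker_smul, neg_add]
    simp only [neg_one_smul]
    rw [show connMatrix g c y = Γ from rfl]
    abel
  have hD : D = pdMatrix c X y - Γ'.transpose * valueMatrix X y - valueMatrix X y * Γ := by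
    ext ⟨e, f⟩ a
    simp [D, X, Γ', Γ, nabla3, pdMatrix, valueMatrix, connMatrix, Matrix.mul_apply,
      Fintype.sum_prod_type, add_mul, Finset.sum_add_distrib, Matrix.one_apply]
    simp only [mul_comm (A e _ f y)]
    ring
  have hpX : pdMatrix c X y = D + Γ'.transpose * valueMatrix X y + valueMatrix X y * Γ := by
    rw [hD]; abel
  have key : Matrix.of (fun a b => nabla2 g (contractOuter g A) c a b y) =
      D.transpose * (valueMatrix G y * valueMatrix X y)
        + (valueMatrix X y).transpose * (valueMatrix G y * D) := by
    have hGX : ∀ p a, DifferentiableAt ℝ (mulArray G X p a) y := fun p a =>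
      DifferentiableAt.fun_sum fun q _ => (hG p q).fun_mul (hX q a)
    have t1 : pdMatrix c (fun a p => X p a) y = (pdMatrix c X y).transpose := rfl
    have t2 : valueMatrix (fun a p => X p a) y = (valueMatrix X y).transpose := rfl
    rw [nabla2_matrix, hS, pdMatrix_mulArray (fun a p => hX p a) hGX, pdMatrix_mulArray hG hX,
      t1, t2, hpG, hpX, show connMatrix g c y = Γ from rfl]
    simp only [valueMatrix_mulArray, t2, Matrix.transpose_add, Matrix.transpose_mul,
      Matrix.transpose_transpose,
      Matrix.add_mul, Matrix.mul_add, Matrix.sub_mul, Matrix.mul_sub, Matrix.neg_mul,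
      Matrix.mul_neg, Matrix.mul_assoc]
    abel
  have := congrFun (congrFun key a) b
  simp only [Matrix.add_apply, Matrix.of_apply, Matrix.mul_apply, Matrix.transpose_apply,
    valueMatrix, D, G, X, Fintype.sum_prod_type, Finset.mul_sum] at this
  rw [this]
  simp only [mul_add, Finset.sum_add_distrib]
  congr 1
  all_goals
    refine Finset.sum_congr rfl fun e _ => ?_
    rw [Finset.sum_comm]
    refine Finset.sum_congr rfl fun f _ => Finset.sum_congr rfl fun e' _ =>
      Finset.sum_congr rfl fun f' _ => by ring

end IsMetricOn

end Contraction

/-! ### Traces of the superenergy tensor and of the Chevreton tensor. -/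

section Traces

variable {g : Comp2} {U : Set R4} {y : R4}

/-- The contraction `A_{aef} A_b^{ef}`. -/
def contractInner (g : Comp2) (A : Comp3) : Comp2 := fun a b y =>
  ∑ e, ∑ e', ∑ f, ∑ f', ginv g e e' y * ginv g f f' y * A a e f y * A b e' f' y

/-- The contraction `A_{acf} A_{bd}^f`. -/
def contractLast (g : Comp2) (A : Comp3) : Comp4 := fun a b c d y =>
  ∑ f, ∑ f', ginv g f f' y * A a c f y * A b d f' y

/-- The trace `g^{ab} T_{ab}`. -/
def metricTrace (g T : Comp2) (y : R4) : ℝ := ∑ a, ∑ b, ginv g a b y * T a b y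

/-- The tensor `S_{ab} - ¼ g_{ab} S^c_c` with `S_{ab} = A_{eaf} A^e_b^f`. -/
def traceFreeOuter (g : Comp2) (A : Comp3) : Comp2 := fun a b y =>
  contractOuter g A a b y - (1 / 4) * g a b y * metricTrace g (contractOuter g A) y

theorem metricTrace_contractInner (g : Comp2) (A : Comp3) (y : R4) :
    metricTrace g (contractInner g A) y = ∑ e, ∑ e', ∑ f, ∑ f', ∑ h, ∑ h',
      ginv g e e' y * ginv g f f' y * ginv g h h' y * A e f h y * A e' f' h' y := by
  simp only [metricTrace, contractInner, Finset.mul_sum, mul_assoc]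

theorem metricTrace_contractOuter (g : Comp2) (A : Comp3) (y : R4) :
    metricTrace g (contractOuter g A) y = metricTrace g (contractInner g A) y := by
  simp only [metricTrace, contractOuter, contractInner, Finset.mul_sum]
  calc _ = ∑ a, ∑ e, ∑ b, ∑ e', ∑ f, ∑ f', ginv g a b y *
        (ginv g e e' y * ginv g f f' y * A e a f y * A e' b f' y) :=
        Finset.sum_congr rfl fun a _ => Finset.sum_comm
    _ = ∑ e, ∑ a, ∑ e', ∑ b, ∑ f, ∑ f', ginv g a b y *
        (ginv g e e' y * ginv g f f' y * A e a f y * A e' b f' y) := by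
        rw [Finset.sum_comm]
        exact Finset.sum_congr rfl fun e _ => Finset.sum_congr rfl fun a _ => Finset.sum_comm
    _ = _ := by
        refine Finset.sum_congr rfl fun e _ => ?_
        rw [Finset.sum_comm]
        refine Finset.sum_congr rfl fun e' _ => Finset.sum_congr rfl fun a _ =>
          Finset.sum_congr rfl fun b _ => Finset.sum_congr rfl fun f _ =>
          Finset.sum_congr rfl fun f' _ => by ring

theorem superenergy_eq (g : Comp2) (A : Comp3) (a b c d : Fin 4) (y : R4) :
    superenergy g A a b c d y = - contractLast g A a b c d y - contractLast g A a b d c y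
      + g a b y * contractOuter g A c d y + (1 / 2) * g c d y * contractInner g A a b y
      - (1 / 4) * g a b y * g c d y * metricTrace g (contractInner g A) y := by
  rw [metricTrace_contractInner]; rfl

theorem trace12_contractLast (g : Comp2) (A : Comp3) (c d : Fin 4) (y : R4) :
    ∑ a, ∑ b, ginv g a b y * contractLast g A a b c d y = contractOuter g A c d y := by
  simp only [contractLast, contractOuter, Finset.mul_sum, mul_assoc]

theorem trace34_contractLast (g : Comp2) (A : Comp3) (a b : Fin 4) (y : R4) :
    ∑ c, ∑ d, ginv g c d y * contractLast g A a b c d y = contractInner g A a b y := by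
  simp only [contractLast, contractInner, Finset.mul_sum, mul_assoc]

theorem chevreton_swap_pairs (g F : Comp2) (a b c d : Fin 4) (y : R4) :
    chevreton g F a b c d y = chevreton g F c d a b y := by
  rw [chevreton, chevreton, add_comm]

namespace IsMetricOn

variable (hg : IsMetricOn g U)
include hg

theorem sum_ginv_swap (hy : y ∈ U) (X : Fin 4 → Fin 4 → ℝ) :
    ∑ a, ∑ b, ginv g a b y * X a b = ∑ a, ∑ b, ginv g a b y * X b a := by
  rw [Finset.sum_comm]
  exact Finset.sum_congr rfl fun a _ => Finset.sum_congr rfl fun b _ => by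
    rw [hg.ginv_symm hy]

theorem trace_metric (hy : y ∈ U) : ∑ a, ∑ b, ginv g a b y * g a b y = 4 := by
  have h := congrArg Matrix.trace (hg.ginv_mul hy)
  simp only [Matrix.trace, Matrix.diag, Matrix.mul_apply, valueMatrix, Matrix.of_apply,
    Matrix.one_apply_eq] at h
  rw [Finset.sum_congr rfl fun a _ => Finset.sum_congr rfl fun b _ => by
    rw [hg.symm y hy a b], h]
  simp

theorem ginv_metric_contract (hy : y ∈ U) (a : Fin 4) (X : Fin 4 → ℝ) :
    ∑ b, ∑ c, ginv g b c y * (g a b y * X c) = X a := by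
  have h : (valueMatrix g y).mulVec ((valueMatrix (ginv g) y).mulVec X) = X := by
    rw [Matrix.mulVec_mulVec, hg.mul_ginv hy, Matrix.one_mulVec]
  rw [← congrFun h a]
  simp only [Matrix.mulVec, dotProduct, valueMatrix, Matrix.of_apply, Finset.mul_sum]
  exact Finset.sum_congr rfl fun b _ => Finset.sum_congr rfl fun c _ => by ring

theorem contractLast_swap (hy : y ∈ U) (A : Comp3) (a b c d : Fin 4) :
    contractLast g A a b c d y = contractLast g A b a d c y := by
  simp only [contractLast, mul_assoc]
  rw [hg.sum_ginv_swap hy]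
  exact Finset.sum_congr rfl fun f _ => Finset.sum_congr rfl fun f' _ => by ring

theorem contractOuter_symm (hy : y ∈ U) (A : Comp3) (a b : Fin 4) :
    contractOuter g A a b y = contractOuter g A b a y := by
  rw [← trace12_contractLast, ← trace12_contractLast, hg.sum_ginv_swap hy]
  exact Finset.sum_congr rfl fun f _ => Finset.sum_congr rfl fun f' _ => by
    rw [hg.contractLast_swap hy]

theorem contractInner_symm (hy : y ∈ U) (A : Comp3) (a b : Fin 4) :
    contractInner g A a b y = contractInner g A b a y := by
  rw [← trace34_contractLast, ← trace34_contractLast, hg.sum_ginv_swap hy]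
  exact Finset.sum_congr rfl fun f _ => Finset.sum_congr rfl fun f' _ => by
    rw [hg.contractLast_swap hy]

theorem superenergy_swap_left (hy : y ∈ U) (A : Comp3) (a b c d : Fin 4) :
    superenergy g A a b c d y = superenergy g A b a c d y := by
  rw [superenergy_eq, superenergy_eq, hg.contractLast_swap hy A a b c d,
    hg.contractLast_swap hy A a b d c, hg.contractInner_symm hy A a b, hg.symm y hy a b]
  ring

theorem superenergy_swap_right (hy : y ∈ U) (A : Comp3) (a b c d : Fin 4) :
    superenergy g A a b c d y = superenergy g A a b d c y := by
  rw [superenergy_eq, superenergy_eq, hg.contractOuter_symm hy A c d, hg.symm y hy c d]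
  ring

theorem trace12_superenergy (hy : y ∈ U) (A : Comp3) (a b : Fin 4) :
    ∑ c, ∑ c', ginv g c c' y * superenergy g A c c' a b y =
      2 * contractOuter g A a b y
        - (1 / 2) * g a b y * metricTrace g (contractInner g A) y := by
  have h : ∀ c c', ginv g c c' y * superenergy g A c c' a b y =
      - (ginv g c c' y * contractLast g A c c' a b y)
      - ginv g c c' y * contractLast g A c c' b a y
      + contractOuter g A a b y * (ginv g c c' y * g c c' y)
      + (1 / 2) * g a b y * (ginv g c c' y * contractInner g A c c' y)
      - (1 / 4) * g a b y * metricTrace g (contractInner g A) y * (ginv g c c' y * g c c' y) := by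
    intro c c'; rw [superenergy_eq]; ring
  simp only [h, Finset.sum_add_distrib, Finset.sum_sub_distrib, Finset.sum_neg_distrib,
    ← Finset.mul_sum, trace12_contractLast, hg.trace_metric hy]
  rw [hg.contractOuter_symm hy A b a, ← metricTrace]
  ring

/-- Dimension four enters through `g^{cd} g_{cd} = 4`: the two inner contractions cancel against `½
· 4` of them, and the multiples of `g_{ab}` cancel because the inner and outer contractions have the
same full trace. -/
theorem trace34_superenergy (hy : y ∈ U) (A : Comp3) (a b : Fin 4) :
    ∑ c, ∑ c', ginv g c c' y * superenergy g A a b c c' y = 0 := by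
  have h : ∀ c c', ginv g c c' y * superenergy g A a b c c' y =
      - (ginv g c c' y * contractLast g A a b c c' y)
      - ginv g c c' y * contractLast g A a b c' c y
      + g a b y * (ginv g c c' y * contractOuter g A c c' y)
      + (1 / 2) * contractInner g A a b y * (ginv g c c' y * g c c' y)
      - (1 / 4) * g a b y * metricTrace g (contractInner g A) y * (ginv g c c' y * g c c' y) := by
    intro c c'; rw [superenergy_eq]; ring
  simp only [h, Finset.sum_add_distrib, Finset.sum_sub_distrib, Finset.sum_neg_distrib,
    ← Finset.mul_sum, trace34_contractLast, hg.trace_metric hy]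
  rw [← hg.sum_ginv_swap hy (fun c c' => contractLast g A a b c c' y), trace34_contractLast,
    ← metricTrace, metricTrace_contractOuter]
  ring

/-- Symmetrizing `E` averages its two pair traces, one of which is zero. -/
theorem chevretonTrace_eq (hy : y ∈ U) (F : Comp2) (a b : Fin 4) :
    chevretonTrace g F a b y = traceFreeOuter g (nabla2 g F) a b y := by
  have h : ∀ c c', ginv g c c' y * chevreton g F c c' a b y =
      (1 / 2) * (ginv g c c' y * superenergy g (nabla2 g F) c c' a b y)
      + (1 / 2) * (ginv g c c' y * superenergy g (nabla2 g F) a b c c' y) := by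
    intro c c'; rw [chevreton]; ring
  simp only [chevretonTrace, h, Finset.sum_add_distrib, ← Finset.mul_sum,
    hg.trace12_superenergy hy, hg.trace34_superenergy hy, traceFreeOuter,
    metricTrace_contractOuter]
  ring

theorem traceFreeOuter_symm (hy : y ∈ U) (A : Comp3) (a b : Fin 4) :
    traceFreeOuter g A a b y = traceFreeOuter g A b a y := by
  rw [traceFreeOuter, traceFreeOuter, hg.contractOuter_symm hy A a b, hg.symm y hy a b]

theorem trace_traceFreeOuter (hy : y ∈ U) (A : Comp3) :
    ∑ a, ∑ b, ginv g a b y * traceFreeOuter g A a b y = 0 := by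
  have h : ∀ a b, ginv g a b y * traceFreeOuter g A a b y =
      ginv g a b y * contractOuter g A a b y
        - (1 / 4) * metricTrace g (contractOuter g A) y * (ginv g a b y * g a b y) := by
    intro a b; rw [traceFreeOuter]; ring
  simp only [h, Finset.sum_sub_distrib, ← Finset.mul_sum, hg.trace_metric hy]
  rw [metricTrace]; ring

theorem trace34_chevreton (hy : y ∈ U) (F : Comp2) (a b : Fin 4) :
    ∑ c, ∑ d, ginv g c d y * chevreton g F a b c d y = traceFreeOuter g (nabla2 g F) a b y := by
  rw [← hg.chevretonTrace_eq hy]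
  simp only [chevretonTrace, chevreton_swap_pairs g F a b]

theorem chevreton_swap_right (hy : y ∈ U) (F : Comp2) (a b c d : Fin 4) :
    chevreton g F a b c d y = chevreton g F a b d c y := by
  rw [chevreton, chevreton, hg.superenergy_swap_right hy _ a b c d,
    hg.superenergy_swap_left hy _ c d a b]

/-- For a divergence-free `A_{abc} = A_{a[bc]}` with `A_{[abc]} = 0`, the inner trace of the
superenergy tensor is a trace-free tensor. -/
theorem trace23_superenergy (hy : y ∈ U) {A : Comp3}
    (hanti : ∀ a b c, A a b c y = - A a c b y)
    (hcyc : ∀ a b c, A a b c y + A b c a y + A c a b y = 0)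
    (htr : ∀ c, ∑ a, ∑ b, ginv g a b y * A a b c y = 0) (a d : Fin 4) :
    ∑ b, ∑ c, ginv g b c y * superenergy g A a b c d y = traceFreeOuter g A a d y := by
  have h : ∀ b c, ginv g b c y * superenergy g A a b c d y =
      - (ginv g b c y * contractLast g A a b c d y)
      - ginv g b c y * contractLast g A a b d c y
      + ginv g b c y * (g a b y * contractOuter g A c d y)
      + (1 / 2) * (ginv g b c y * (g d c y * contractInner g A a b y))
      - (1 / 4) * metricTrace g (contractInner g A) y *
        (ginv g b c y * (g a b y * g c d y)) := by
    intro b c; rw [superenergy_eq, hg.symm y hy d c]; ring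
  -- The contraction falls on the first two indices of a single factor `A`, where `htr` applies.
  have h1 : ∑ b, ∑ c, ginv g b c y * contractLast g A a b d c y = 0 := by
    have : ∀ b c, ginv g b c y * contractLast g A a b d c y =
        ∑ f, ∑ f', ginv g f f' y * A a d f y * (ginv g b c y * A b c f' y) := by
      intro b c
      simp only [contractLast, Finset.mul_sum]
      exact Finset.sum_congr rfl fun f _ => Finset.sum_congr rfl fun f' _ => by ring
    simp only [this]
    calc _ = ∑ f, ∑ f', ∑ b, ∑ c, ginv g f f' y * A a d f y * (ginv g b c y * A b c f' y) := by
          rw [Finset.sum_congr rfl fun b _ => Finset.sum_comm, Finset.sum_comm]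
          refine Finset.sum_congr rfl fun f _ => ?_
          rw [Finset.sum_congr rfl fun b _ => Finset.sum_comm, Finset.sum_comm]
      _ = 0 := by simp only [← Finset.mul_sum, htr, mul_zero, Finset.sum_const_zero]
  -- Since `A_{acf}` is antisymmetric in `c, f`, only the antisymmetric part of the other factor
  -- counts; the cyclic identity turns `A_{bdf} - A_{fdb}` into `A_{dbf}`, whence the factor `½`.
  -- The result cancels the term `½ g_{cd} A_{aef} A_b^{ef}` of the superenergy tensor after
  -- contraction.
  have h2 : ∑ b, ∑ c, ginv g b c y * contractLast g A a b c d y =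
      (1 / 2) * contractInner g A a d y := by
    let P : (Fin 4 → Fin 4 → ℝ) → ℝ := fun Y =>
      ∑ c, ∑ b, ∑ f, ∑ f', ginv g c b y * ginv g f f' y * A a c f y * Y b f'
    have p1 : ∑ b, ∑ c, ginv g b c y * contractLast g A a b c d y = P fun b f => A b d f y := by
      simp only [contractLast, Finset.mul_sum, P]
      rw [Finset.sum_comm]
      refine Finset.sum_congr rfl fun c _ => Finset.sum_congr rfl fun b _ =>
        Finset.sum_congr rfl fun f _ => Finset.sum_congr rfl fun f' _ => ?_
      rw [hg.ginv_symm hy b c]; ring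
    have p2 : (P fun b f => A b d f y) = P fun b f => - A f d b y := by
      simp only [P]
      calc _ = ∑ f, ∑ f', ∑ c, ∑ b, ginv g c b y * ginv g f f' y * A a c f y * A b d f' y := by
            rw [Finset.sum_congr rfl fun c _ => Finset.sum_comm, Finset.sum_comm]
            refine Finset.sum_congr rfl fun f _ => ?_
            rw [Finset.sum_congr rfl fun c _ => Finset.sum_comm, Finset.sum_comm]
        _ = _ := by
            refine Finset.sum_congr rfl fun c _ => Finset.sum_congr rfl fun b _ =>
              Finset.sum_congr rfl fun f _ => Finset.sum_congr rfl fun f' _ => ?_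
            rw [hanti a f c]; ring
    have p3 : (P fun b f => A b d f y) + (P fun b f => - A f d b y) =
        P fun b f => A d b f y := by
      simp only [P, ← Finset.sum_add_distrib, ← mul_add]
      refine Finset.sum_congr rfl fun c _ => Finset.sum_congr rfl fun b _ =>
        Finset.sum_congr rfl fun f _ => Finset.sum_congr rfl fun f' _ => ?_
      congr 1
      linear_combination hcyc b d f' - hanti d b f' - hanti f' d b
    have p4 : (P fun b f => A d b f y) = contractInner g A a d y := rfl
    rw [p1]; linarith
  simp only [h, Finset.sum_add_distrib, Finset.sum_sub_distrib, Finset.sum_neg_distrib,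
    ← Finset.mul_sum, h1, h2]
  rw [hg.ginv_metric_contract hy a fun c => contractOuter g A c d y,
    hg.ginv_metric_contract hy a fun c => g c d y,
    hg.sum_ginv_swap hy fun b c => g d c y * contractInner g A a b y,
    hg.ginv_metric_contract hy d fun c => contractInner g A a c y,
    traceFreeOuter, metricTrace_contractOuter]
  ring

theorem trace23_chevreton (hy : y ∈ U) {F : Comp2}
    (hanti : ∀ a b c, nabla2 g F a b c y = - nabla2 g F a c b y)
    (hcyc : ∀ a b c, nabla2 g F a b c y + nabla2 g F b c a y + nabla2 g F c a b y = 0)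
    (htr : ∀ c, ∑ a, ∑ b, ginv g a b y * nabla2 g F a b c y = 0) (a d : Fin 4) :
    ∑ b, ∑ c, ginv g b c y * chevreton g F a b c d y =
      traceFreeOuter g (nabla2 g F) a d y := by
  have h : ∀ b c, ginv g b c y * chevreton g F a b c d y =
      (1 / 2) * (ginv g b c y * superenergy g (nabla2 g F) a b c d y)
      + (1 / 2) * (ginv g b c y * superenergy g (nabla2 g F) d c b a y) := by
    intro b c
    rw [chevreton, hg.superenergy_swap_left hy _ c d a b, hg.superenergy_swap_right hy _ d c a b]
    ring
  simp only [h, Finset.sum_add_distrib, ← Finset.mul_sum]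
  rw [hg.trace23_superenergy hy hanti hcyc htr,
    ← hg.sum_ginv_swap hy fun b c => superenergy g (nabla2 g F) d b c a y,
    hg.trace23_superenergy hy hanti hcyc htr, hg.traceFreeOuter_symm hy _ d a]
  ring

end IsMetricOn

end Traces

/-! ### Divergences and their traces. -/

section Divergence

variable {g : Comp2} {U : Set R4} {y : R4}

/-- With `div4_swap_right`, reduces a trace over any two free indices to the trace over the last
two. -/
theorem div4_swap (g : Comp2) (T : Comp4) (b c d : Fin 4) (y : R4) :
    div4 g T b c d y = div4 g (fun a b c d => T a c b d) c b d y := by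
  refine Finset.sum_congr rfl fun a _ => Finset.sum_congr rfl fun a' _ => ?_
  simp only [nabla4]; ring

theorem div4_swap_right (g : Comp2) (T : Comp4) (b c d : Fin 4) (y : R4) :
    div4 g T b c d y = div4 g (fun a b c d => T a b d c) b d c y := by
  refine Finset.sum_congr rfl fun a _ => Finset.sum_congr rfl fun a' _ => ?_
  simp only [nabla4]; ring

namespace IsMetricOn

variable (hg : IsMetricOn g U)
include hg

theorem smooth_trace {X : Comp2} (hX : ∀ a b, ContDiffOn ℝ ∞ (X a b) U) :
    ContDiffOn ℝ ∞ (fun x => ∑ a, ∑ b, ginv g a b x * X a b x) U :=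
  ContDiffOn.sum fun a _ => ContDiffOn.sum fun b _ => (hg.smooth_ginv a b).mul (hX a b)

theorem smooth_contractLast {A : Comp3} (hA : ∀ e a b, ContDiffOn ℝ ∞ (A e a b) U)
    (a b c d : Fin 4) : ContDiffOn ℝ ∞ (contractLast g A a b c d) U := by
  have := hg.smooth_trace (X := fun f f' x => A a c f x * A b d f' x)
    fun f f' => (hA a c f).mul (hA b d f')
  refine this.congr fun x _ => ?_
  simp only [contractLast, mul_assoc]

theorem smooth_contractOuter {A : Comp3} (hA : ∀ e a b, ContDiffOn ℝ ∞ (A e a b) U)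
    (a b : Fin 4) : ContDiffOn ℝ ∞ (contractOuter g A a b) U :=
  (hg.smooth_trace fun c d => hg.smooth_contractLast hA c d a b).congr fun x _ =>
    (trace12_contractLast g A a b x).symm

theorem smooth_contractInner {A : Comp3} (hA : ∀ e a b, ContDiffOn ℝ ∞ (A e a b) U)
    (a b : Fin 4) : ContDiffOn ℝ ∞ (contractInner g A a b) U :=
  (hg.smooth_trace fun c d => hg.smooth_contractLast hA a b c d).congr fun x _ =>
    (trace34_contractLast g A a b x).symm

theorem smooth_superenergy {A : Comp3} (hA : ∀ e a b, ContDiffOn ℝ ∞ (A e a b) U)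
    (a b c d : Fin 4) : ContDiffOn ℝ ∞ (superenergy g A a b c d) U := by
  have h1 := hg.smooth_contractLast hA
  have h2 := hg.smooth_contractInner hA
  have h3 := hg.smooth_contractOuter hA
  have h4 := hg.smooth
  refine ContDiffOn.congr ?_ fun x _ => superenergy_eq g A a b c d x
  exact (((((h1 a b c d).neg).sub (h1 a b d c)).add ((h4 a b).mul (h3 c d))).add
    ((contDiffOn_const.mul (h4 c d)).mul (h2 a b))).sub
    (((contDiffOn_const.mul (h4 a b)).mul (h4 c d)).mul (hg.smooth_trace h2))

theorem smooth_chevreton {F : Comp2} (hF : ∀ a b, ContDiffOn ℝ ∞ (F a b) U)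
    (a b c d : Fin 4) : ContDiffOn ℝ ∞ (chevreton g F a b c d) U :=
  contDiffOn_const.mul ((hg.smooth_superenergy (hg.smooth_nabla2 hF) a b c d).add
    (hg.smooth_superenergy (hg.smooth_nabla2 hF) c d a b))

/-- The trace over the last two indices commutes with the covariant derivative. -/
theorem trace34_nabla4 {T : Comp4} (hT : ∀ a b c d, ContDiffOn ℝ ∞ (T a b c d) U) (hy : y ∈ U)
    (e a b : Fin 4) : ∑ c, ∑ d, ginv g c d y * nabla4 g T e a b c d y =
      nabla2 g (fun a b x => ∑ c, ∑ d, ginv g c d x * T a b c d x) e a b y := by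
  have h1 : ∀ c d, nabla4 g T e a b c d y = nabla2 g (T a b) e c d y
      - (∑ f, christoffel g f e a y * T f b c d y)
      - ∑ f, christoffel g f e b y * T a f c d y := by
    intro c d; simp only [nabla4, nabla2]; ring
  have hs : ∀ (i : Fin 4) (X : Fin 4 → Fin 4 → Fin 4 → ℝ),
      ∑ c, ∑ d, ginv g c d y * ∑ f, christoffel g f e i y * X f c d =
      ∑ f, christoffel g f e i y * ∑ c, ∑ d, ginv g c d y * X f c d := by
    intro i X
    simp only [Finset.mul_sum]
    rw [Finset.sum_congr rfl fun c _ => Finset.sum_comm, Finset.sum_comm]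
    exact Finset.sum_congr rfl fun f _ => Finset.sum_congr rfl fun c _ =>
      Finset.sum_congr rfl fun d _ => by ring
  simp only [h1, mul_sub, Finset.sum_sub_distrib]
  rw [hg.contract_nabla2 hy fun c d => smooth_differentiableAt hg.isOpen (hT a b c d) hy,
    hs a fun f c d => T f b c d y, hs b fun f c d => T a f c d y]
  rfl

theorem trace34_div4 {T : Comp4} (hT : ∀ a b c d, ContDiffOn ℝ ∞ (T a b c d) U) (hy : y ∈ U)
    {H : Comp2} (hH : ∀ x ∈ U, ∀ a b, ∑ c, ∑ d, ginv g c d x * T a b c d x = H a b x)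
    (b : Fin 4) : ∑ c, ∑ d, ginv g c d y * div4 g T b c d y = div2 g H b y := by
  have h : ∀ a a', ∑ c, ∑ d, ginv g c d y * nabla4 g T a' a b c d y = nabla2 g H a' a b y := by
    intro a a'
    rw [hg.trace34_nabla4 hT hy, nabla2_congr g hg.isOpen hH hy]
  simp only [div2, ← h, div4, Finset.mul_sum]
  calc _ = ∑ c, ∑ a, ∑ d, ∑ a', ginv g c d y * (ginv g a a' y * nabla4 g T a' a b c d y) :=
        Finset.sum_congr rfl fun c _ => Finset.sum_comm
    _ = ∑ a, ∑ c, ∑ a', ∑ d, ginv g c d y * (ginv g a a' y * nabla4 g T a' a b c d y) := by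
        rw [Finset.sum_comm]
        exact Finset.sum_congr rfl fun a _ => Finset.sum_congr rfl fun c _ => Finset.sum_comm
    _ = _ := by
        refine Finset.sum_congr rfl fun a _ => ?_
        rw [Finset.sum_comm]
        exact Finset.sum_congr rfl fun a' _ => Finset.sum_congr rfl fun c _ =>
          Finset.sum_congr rfl fun d _ => by ring

theorem trace24_div4 {T : Comp4} (hT : ∀ a b c d, ContDiffOn ℝ ∞ (T a b c d) U) (hy : y ∈ U)
    {H : Comp2} (hH : ∀ x ∈ U, ∀ a c, ∑ b, ∑ d, ginv g b d x * T a b c d x = H a c x)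
    (c : Fin 4) : ∑ b, ∑ d, ginv g b d y * div4 g T b c d y = div2 g H c y := by
  simp only [div4_swap g T]
  exact hg.trace34_div4 (fun a b c d => hT a c b d) hy hH c

theorem trace23_div4 {T : Comp4} (hT : ∀ a b c d, ContDiffOn ℝ ∞ (T a b c d) U) (hy : y ∈ U)
    {H : Comp2} (hH : ∀ x ∈ U, ∀ a d, ∑ b, ∑ c, ginv g b c x * T a b c d x = H a d x)
    (d : Fin 4) : ∑ b, ∑ c, ginv g b c y * div4 g T b c d y = div2 g H d y := by
  simp only [div4_swap_right g T]
  exact hg.trace24_div4 (fun a b c d => hT a b d c) hy hH d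

theorem nabla2_traceFreeOuter {A : Comp3} (hA : ∀ e a b, ContDiffOn ℝ ∞ (A e a b) U) (hy : y ∈ U)
    (c a b : Fin 4) : nabla2 g (traceFreeOuter g A) c a b y =
      nabla2 g (contractOuter g A) c a b y
        - (1 / 4) * g a b y *
          ∑ p, ∑ q, ginv g p q y * nabla2 g (contractOuter g A) c p q y := by
  have hd : ∀ a b, DifferentiableAt ℝ (contractOuter g A a b) y := fun a b =>
    smooth_differentiableAt hg.isOpen (hg.smooth_contractOuter hA a b) hy
  have hgd : DifferentiableAt ℝ (g a b) y :=
    smooth_differentiableAt hg.isOpen (hg.smooth a b) hy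
  have ht : DifferentiableAt ℝ (metricTrace g (contractOuter g A)) y :=
    smooth_differentiableAt hg.isOpen (hg.smooth_trace (hg.smooth_contractOuter hA)) hy
  have h0 : pd c (traceFreeOuter g A a b) y = pd c (contractOuter g A a b) y
      - (1 / 4) * (pd c (g a b) y * metricTrace g (contractOuter g A) y
        + g a b y * pd c (metricTrace g (contractOuter g A)) y) := by
    have : traceFreeOuter g A a b = fun x => contractOuter g A a b x
        - (1 / 4) * (g a b x * metricTrace g (contractOuter g A) x) := by
      funext x; rw [traceFreeOuter]; ring
    rw [this, pd_sub (hd a b) ((hgd.fun_mul ht).const_mul _),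
      pd_mul (differentiableAt_const _) (hgd.fun_mul ht), pd_const, pd_mul hgd ht]
    ring
  have hm := hg.nabla_metric hy c a b
  rw [hg.contract_nabla2 hy hd]
  change _ = _ - (1 / 4) * g a b y * pd c (metricTrace g (contractOuter g A)) y
  simp only [nabla2, h0, traceFreeOuter, mul_sub, Finset.sum_sub_distrib] at hm ⊢
  have e1 : ∀ i (X : Fin 4 → ℝ), ∑ d, christoffel g d c i y *
      ((1 / 4) * X d * metricTrace g (contractOuter g A) y) =
      (1 / 4) * metricTrace g (contractOuter g A) y * ∑ d, christoffel g d c i y * X d := by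
    intro i X
    rw [Finset.mul_sum]
    exact Finset.sum_congr rfl fun d _ => by ring
  rw [e1 a fun d => g d b y, e1 b fun d => g a d y]
  -- The connection terms acting on `g_{ab}` complete `∂g` to `∇g`, which is zero by `hm`.
  linear_combination (-1 / 4) * metricTrace g (contractOuter g A) y * hm

end IsMetricOn

end Divergence

/-! ### Components in a frame at a single point. -/

section Frames

/-- The signs of the Minkowski metric. -/
def minkowskiSign (i : Fin 4) : ℝ := if i = 0 then 1 else -1

variable (E : Fin 4 → Fin 4 → ℝ)

/-- The components `X(e_i)` of a covector in the frame `e_i = E_i^a ∂_a`. -/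
def toFrame1 (X : Fin 4 → ℝ) (i : Fin 4) : ℝ := ∑ a, E i a * X a

/-- The components of a tensor of rank 2 in a frame. -/
def toFrame2 (X : Fin 4 → Fin 4 → ℝ) (i j : Fin 4) : ℝ :=
  toFrame1 E (fun a => toFrame1 E (X a) j) i

/-- The components of a tensor of rank 3 in a frame. -/
def toFrame3 (X : Fin 4 → Fin 4 → Fin 4 → ℝ) (i j k : Fin 4) : ℝ :=
  toFrame1 E (fun a => toFrame2 E (X a) j k) i

/-- The components of a tensor of rank 4 in a frame. -/
def toFrame4 (X : Fin 4 → Fin 4 → Fin 4 → Fin 4 → ℝ) (i j k l : Fin 4) : ℝ :=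
  toFrame1 E (fun a => toFrame3 E (X a) j k l) i

theorem toFrame1_add (X Y : Fin 4 → ℝ) (i : Fin 4) :
    toFrame1 E (fun a => X a + Y a) i = toFrame1 E X i + toFrame1 E Y i := by
  simp only [toFrame1, mul_add, Finset.sum_add_distrib]

theorem toFrame1_sub (X Y : Fin 4 → ℝ) (i : Fin 4) :
    toFrame1 E (fun a => X a - Y a) i = toFrame1 E X i - toFrame1 E Y i := by
  simp only [toFrame1, mul_sub, Finset.sum_sub_distrib]

theorem toFrame1_neg (X : Fin 4 → ℝ) (i : Fin 4) :
    toFrame1 E (fun a => - X a) i = - toFrame1 E X i := by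
  simp only [toFrame1, mul_neg, Finset.sum_neg_distrib]

theorem toFrame1_zero (i : Fin 4) : toFrame1 E (fun _ => 0) i = 0 := by
  simp only [toFrame1, mul_zero, Finset.sum_const_zero]

theorem toFrame1_const_mul (r : ℝ) (X : Fin 4 → ℝ) (i : Fin 4) :
    toFrame1 E (fun a => r * X a) i = r * toFrame1 E X i := by
  simp only [toFrame1, Finset.mul_sum]
  exact Finset.sum_congr rfl fun a _ => by ring

theorem toFrame1_mul_const (r : ℝ) (X : Fin 4 → ℝ) (i : Fin 4) :
    toFrame1 E (fun a => X a * r) i = toFrame1 E X i * r := by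
  simp only [mul_comm _ r, toFrame1_const_mul]

theorem toFrame1_sum (X : Fin 4 → Fin 4 → ℝ) (i : Fin 4) :
    toFrame1 E (fun a => ∑ m, X m a) i = ∑ m, toFrame1 E (X m) i := by
  simp only [toFrame1, Finset.mul_sum]
  exact Finset.sum_comm

theorem toFrame2_swap (X : Fin 4 → Fin 4 → ℝ) (i j : Fin 4) :
    toFrame2 E X i j = toFrame2 E (fun a b => X b a) j i := by
  simp only [toFrame2, toFrame1, Finset.mul_sum]
  rw [Finset.sum_comm]
  exact Finset.sum_congr rfl fun a _ => Finset.sum_congr rfl fun b _ => by ring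

theorem toFrame3_swap_right (X : Fin 4 → Fin 4 → Fin 4 → ℝ) (i j k : Fin 4) :
    toFrame3 E X i j k = toFrame3 E (fun a b c => X a c b) i k j := by
  simp only [toFrame3, toFrame2_swap E _ j k]

theorem toFrame3_swap_left (X : Fin 4 → Fin 4 → Fin 4 → ℝ) (i j k : Fin 4) :
    toFrame3 E X i j k = toFrame3 E (fun a b c => X b a c) j i k :=
  toFrame2_swap E (fun a b => toFrame1 E (X a b) k) i j

theorem toFrame3_rotate (X : Fin 4 → Fin 4 → Fin 4 → ℝ) (i j k : Fin 4) :
    toFrame3 E X j k i = toFrame3 E (fun a b c => X b c a) i j k := by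
  conv_lhs => rw [toFrame3_swap_right, toFrame3_swap_left]

theorem toFrame4_swap34 (X : Fin 4 → Fin 4 → Fin 4 → Fin 4 → ℝ) (i j k l : Fin 4) :
    toFrame4 E X i j k l = toFrame4 E (fun a b c d => X a b d c) i j l k := by
  simp only [toFrame4, toFrame3_swap_right E _ j k l]

theorem toFrame4_swap23 (X : Fin 4 → Fin 4 → Fin 4 → Fin 4 → ℝ) (i j k l : Fin 4) :
    toFrame4 E X i j k l = toFrame4 E (fun a b c d => X a c b d) i k j l := by
  simp only [toFrame4, toFrame3_swap_left E _ j k l]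

theorem toFrame4_swap12 (X : Fin 4 → Fin 4 → Fin 4 → Fin 4 → ℝ) (i j k l : Fin 4) :
    toFrame4 E X i j k l = toFrame4 E (fun a b c d => X b a c d) j i k l :=
  toFrame2_swap E (fun a b => toFrame2 E (X a b) k l) i j

theorem toFrame3_antisymm {X : Fin 4 → Fin 4 → Fin 4 → ℝ} (h : ∀ a b c, X a b c = - X a c b)
    (i j k : Fin 4) : toFrame3 E X i j k = - toFrame3 E X i k j := by
  rw [toFrame3_swap_right]
  simp only [toFrame3, toFrame2, ← toFrame1_neg, ← h]

theorem toFrame3_cyclic {X : Fin 4 → Fin 4 → Fin 4 → ℝ}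
    (h : ∀ a b c, X a b c + X b c a + X c a b = 0) (i j k : Fin 4) :
    toFrame3 E X i j k + toFrame3 E X j k i + toFrame3 E X k i j = 0 := by
  rw [(toFrame3_rotate E X j k i).trans (toFrame3_rotate E (fun a b c => X b c a) i j k),
    toFrame3_rotate E X i j k]
  simp only [toFrame3, toFrame2, ← toFrame1_add, h, toFrame1_zero]

variable {E}
variable {G : Fin 4 → Fin 4 → ℝ} (hG : ∀ a b, G a b = ∑ i, minkowskiSign i * E i a * E i b)
include hG

theorem contract_eq_frame (X : Fin 4 → Fin 4 → ℝ) :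
    ∑ a, ∑ b, G a b * X a b = ∑ i, minkowskiSign i * toFrame2 E X i i := by
  simp only [hG, toFrame2, toFrame1, Finset.mul_sum, Finset.sum_mul]
  rw [Finset.sum_congr rfl fun a _ => Finset.sum_comm, Finset.sum_comm]
  exact Finset.sum_congr rfl fun i _ => Finset.sum_congr rfl fun a _ =>
    Finset.sum_congr rfl fun b _ => by ring

theorem contract_mul_eq_frame (X Y : Fin 4 → ℝ) :
    ∑ a, ∑ b, G a b * (X a * Y b) = ∑ i, minkowskiSign i * (toFrame1 E X i * toFrame1 E Y i) := by
  rw [contract_eq_frame hG]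
  refine Finset.sum_congr rfl fun i _ => ?_
  simp only [toFrame2, toFrame1_const_mul, toFrame1_mul_const]

theorem contract2_mul_eq_frame (X Y : Fin 4 → Fin 4 → ℝ) :
    ∑ a, ∑ a', ∑ b, ∑ b', G a a' * G b b' * (X a b * Y a' b') =
      ∑ i, ∑ j, minkowskiSign i * minkowskiSign j * (toFrame2 E X i j * toFrame2 E Y i j) := by
  have h : ∀ a a', ∑ b, ∑ b', G a a' * G b b' * (X a b * Y a' b') =
      ∑ j, minkowskiSign j * (G a a' * (toFrame1 E (X a) j * toFrame1 E (Y a') j)) := by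
    intro a a'
    simp only [mul_assoc, ← Finset.mul_sum]
    rw [contract_mul_eq_frame hG, Finset.mul_sum]
    exact Finset.sum_congr rfl fun j _ => by ring
  simp only [h]
  rw [Finset.sum_congr rfl fun a _ => Finset.sum_comm, Finset.sum_comm]
  simp only [← Finset.mul_sum]
  rw [Finset.sum_comm' (s := Finset.univ) (t := fun _ => Finset.univ) (t' := Finset.univ)
    (s' := fun _ => Finset.univ) (by simp)]
  simp only [contract_mul_eq_frame hG, Finset.mul_sum, mul_assoc]
  refine Finset.sum_congr rfl fun i _ => Finset.sum_congr rfl fun j _ => ?_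
  simp only [toFrame2]
  ring

theorem frame_trace_zero {X : Fin 4 → Fin 4 → Fin 4 → ℝ}
    (h : ∀ c, ∑ a, ∑ b, G a b * X a b c = 0) (k : Fin 4) :
    ∑ i, minkowskiSign i * toFrame3 E X i i k = 0 := by
  have h1 := contract_eq_frame hG fun a b => toFrame1 E (X a b) k
  refine h1.symm.trans ?_
  simp only [← toFrame1_const_mul, ← toFrame1_sum, h, toFrame1_zero]

end Frames

/-! ### Algebraic identities in four dimensions for the curvature terms. -/

section FrameAlgebra

/-- The commutator `[∇_a, ∇_e] F_{bf}` in an orthonormal frame. -/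
def frameCommutator (R : Fin 4 → Fin 4 → Fin 4 → Fin 4 → ℝ) (F : Fin 4 → Fin 4 → ℝ)
    (a e b f : Fin 4) : ℝ :=
  - ∑ d, minkowskiSign d * (R d b a e * F d f + R d f a e * F b d)

/-- The curvature terms in the divergence of `A_{eaf} A^e_b^f - ¼ g_{ab} A_{efh} A^{efh}`. -/
def curvatureTerm (R : Fin 4 → Fin 4 → Fin 4 → Fin 4 → ℝ) (F : Fin 4 → Fin 4 → ℝ)
    (A : Fin 4 → Fin 4 → Fin 4 → ℝ) (k : Fin 4) : ℝ :=
  ∑ a, ∑ e, ∑ f, minkowskiSign a * minkowskiSign e * minkowskiSign f *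
    (A e k f * frameCommutator R F a e a f
      + A e a f * (frameCommutator R F a e k f + (1 / 2) * frameCommutator R F e k a f))

/-- The dependent components of a trace-free `A_{abc} = A_{a[bc]}` with `A_{[abc]} = 0`. -/
theorem dependent_components {A : Fin 4 → Fin 4 → Fin 4 → ℝ}
    (hA : ∀ a b c, A a b c = - A a c b) (hAc : ∀ a b c, A a b c + A b c a + A c a b = 0)
    (hAt : ∀ c, ∑ a, minkowskiSign a * A a a c = 0) :
    A 0 1 2 = A 1 0 2 - A 2 0 1 ∧
    A 0 1 3 = A 1 0 3 - A 3 0 1 ∧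
    A 0 2 3 = A 2 0 3 - A 3 0 2 ∧
    A 1 2 3 = A 2 1 3 - A 3 1 2 ∧
    A 3 0 3 = - A 1 0 1 - A 2 0 2 ∧
    A 3 1 3 = - A 0 0 1 - A 2 1 2 ∧
    A 3 2 3 = A 1 1 2 - A 0 0 2 ∧
    A 2 2 3 = A 0 0 3 - A 1 1 3 := by
  have hA0 : ∀ a i, A a i i = 0 := fun a i => by linarith [hA a i i]
  simp only [Fin.sum_univ_four, minkowskiSign, Fin.isValue, if_true, one_ne_zero, if_false,
    Fin.reduceEq] at hAt
  have a0 := hAt 0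
  have a1 := hAt 1
  have a2 := hAt 2
  have a3 := hAt 3
  have c0 := hAc 0 1 2
  have c1 := hAc 0 1 3
  have c2 := hAc 0 2 3
  have c3 := hAc 1 2 3
  simp only [hA0, hA _ 1 0, hA _ 2 0, hA _ 3 0, hA _ 2 1,
    hA _ 3 1, hA _ 3 2] at a0 a1 a2 a3 c0 c1 c2 c3
  -- Of the 24 components antisymmetric in the last two indices, four are fixed by the cyclic
  -- identities and four by the traces.
  refine ⟨?_, ?_, ?_, ?_, ?_, ?_, ?_, ?_⟩ <;> linarith

/-- The linear relations on `W` and `A` are solved for independent components; what is left is a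
polynomial identity, checked for each value of `k`. -/
theorem curvatureTerm_weyl {W : Fin 4 → Fin 4 → Fin 4 → Fin 4 → ℝ} {F : Fin 4 → Fin 4 → ℝ}
    {A : Fin 4 → Fin 4 → Fin 4 → ℝ}
    (hl : ∀ a b c d, W a b c d = - W b a c d) (hr : ∀ a b c d, W a b c d = - W a b d c)
    (hp : ∀ a b c d, W a b c d = W c d a b)
    (hc : ∀ a b c d, W a b c d + W a c d b + W a d b c = 0)
    (ht : ∀ a b, ∑ c, minkowskiSign c * W c a c b = 0)
    (hF : ∀ a b, F a b = - F b a) (hA : ∀ a b c, A a b c = - A a c b)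
    (hAc : ∀ a b c, A a b c + A b c a + A c a b = 0)
    (hAt : ∀ c, ∑ a, minkowskiSign a * A a a c = 0) (k : Fin 4) :
    curvatureTerm W F A k = 0 := by
  have hl0 : ∀ i c d, W i i c d = 0 := fun i c d => by linarith [hl i i c d]
  have hr0 : ∀ i c d, W c d i i = 0 := fun i c d => by linarith [hr c d i i]
  have hF0 : ∀ i, F i i = 0 := fun i => by linarith [hF i i]
  have hA0 : ∀ a i, A a i i = 0 := fun a i => by linarith [hA a i i]
  simp only [Fin.sum_univ_four, minkowskiSign, Fin.isValue, if_true, one_ne_zero, if_false,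
    Fin.reduceEq] at ht
  have t00 := ht 0 0
  have t01 := ht 0 1
  have t02 := ht 0 2
  have t03 := ht 0 3
  have t11 := ht 1 1
  have t12 := ht 1 2
  have t13 := ht 1 3
  have t22 := ht 2 2
  have t23 := ht 2 3
  have t33 := ht 3 3
  have tc := hc 0 1 2 3
  simp only [hl0, hr0, hl 1 0, hl 2 0, hl 3 0, hl 2 1, hl 3 1, hl 3 2, hr _ _ 1 0, hr _ _ 2 0,
    hr _ _ 3 0, hr _ _ 2 1, hr _ _ 3 1, hr _ _ 3 2] at t00 t01 t02 t03 t11 t12 t13 t22 t23 t33 tc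
  -- Pair symmetry leaves 21 components; ten trace conditions and one cyclic identity determine
  -- eleven of them by the other ten.
  have w1 : W 0 3 0 3 = - W 0 1 0 1 - W 0 2 0 2 := by linarith
  have w2 : W 1 2 1 2 = W 0 1 0 1 + W 0 2 0 2 := by linarith
  have w3 : W 1 3 1 3 = - W 0 2 0 2 := by linarith
  have w4 : W 2 3 2 3 = - W 0 1 0 1 := by linarith
  have w5 : W 1 3 2 3 = W 0 1 0 2 := by linarith
  have w6 : W 1 2 2 3 = - W 0 1 0 3 := by linarith
  have w7 : W 1 2 1 3 = W 0 2 0 3 := by linarith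
  have w8 : W 0 3 1 3 = - W 0 2 1 2 := by linarith
  have w9 : W 0 3 2 3 = W 0 1 1 2 := by linarith
  have w10 : W 0 2 2 3 = - W 0 1 1 3 := by linarith
  have w11 : W 0 3 1 2 = W 0 2 1 3 - W 0 1 2 3 := by linarith
  obtain ⟨b0, b1, b2, b3, b4, b5, b6, b7⟩ := dependent_components hA hAc hAt
  obtain rfl | rfl | rfl | rfl : k = 0 ∨ k = 1 ∨ k = 2 ∨ k = 3 := by omega
  all_goals
    simp only [curvatureTerm, frameCommutator, Fin.sum_univ_four, minkowskiSign, Fin.isValue,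
      if_true, one_ne_zero, if_false, Fin.reduceEq,
      hl0, hr0, hl 1 0, hl 2 0, hl 3 0, hl 2 1, hl 3 1, hl 3 2, hr _ _ 1 0, hr _ _ 2 0,
      hr _ _ 3 0, hr _ _ 2 1, hr _ _ 3 1, hr _ _ 3 2, hp 0 2 0 1, hp 0 3 0 1, hp 0 3 0 2,
      hp 1 2 0 1, hp 1 2 0 2, hp 1 2 0 3, hp 1 3 0 1, hp 1 3 0 2, hp 1 3 0 3, hp 1 3 1 2,
      hp 2 3 0 1, hp 2 3 0 2, hp 2 3 0 3, hp 2 3 1 2, hp 2 3 1 3,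
      hF0, hA0, hF 1 0, hF 2 0, hF 3 0, hF 2 1, hF 3 1, hF 3 2, hA _ 1 0, hA _ 2 0, hA _ 3 0,
      hA _ 2 1, hA _ 3 1, hA _ 3 2]
    simp only [w1, w2, w3, w4, w5, w6, w7, w8, w9, w10, w11, b0, b1, b2, b3, b4, b5, b6, b7]
    ring

/-- The Minkowski metric. -/
def minkowski (i j : Fin 4) : ℝ := if i = j then minkowskiSign i else 0

/-- The electromagnetic energy-momentum tensor in an orthonormal frame. -/
def frameEmTensor (F : Fin 4 → Fin 4 → ℝ) (i j : Fin 4) : ℝ :=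
  - (∑ c, minkowskiSign c * (F i c * F j c))
    + (1 / 4) * minkowski i j * ∑ c, ∑ d, minkowskiSign c * minkowskiSign d * (F c d * F c d)

/-- The Kulkarni-Nomizu product of the Minkowski metric with a bilinear form. -/
def kulkarniNomizu (P : Fin 4 → Fin 4 → ℝ) (a b c d : Fin 4) : ℝ :=
  minkowski a c * P b d + minkowski b d * P a c - minkowski a d * P b c - minkowski b c * P a d

/-- The curvature terms in the divergence for the Kulkarni-Nomizu product of `P` with the metric. -/
def ricciTerm (P F : Fin 4 → Fin 4 → ℝ) (A : Fin 4 → Fin 4 → Fin 4 → ℝ) (k : Fin 4) : ℝ :=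
  (∑ e, ∑ d, ∑ f, minkowskiSign e * minkowskiSign d * minkowskiSign f *
    (2 * P e d * F d f * A e k f - 2 * P e d * F d f * A k e f - P k e * F d f * A e d f
      + 2 * P e d * F k f * A e d f))
  + (1 / 2) * (∑ e, minkowskiSign e * P e e) *
    ∑ e, ∑ f, minkowskiSign e * minkowskiSign f * (F e f * A k e f)

theorem curvatureTerm_kulkarniNomizu {P F : Fin 4 → Fin 4 → ℝ} {A : Fin 4 → Fin 4 → Fin 4 → ℝ}
    (hP : ∀ a b, P a b = P b a)
    (hF : ∀ a b, F a b = - F b a) (hA : ∀ a b c, A a b c = - A a c b)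
    (hAc : ∀ a b c, A a b c + A b c a + A c a b = 0)
    (hAt : ∀ c, ∑ a, minkowskiSign a * A a a c = 0) (k : Fin 4) :
    curvatureTerm (kulkarniNomizu P) F A k = ricciTerm P F A k := by
  have hF0 : ∀ i, F i i = 0 := fun i => by linarith [hF i i]
  have hA0 : ∀ a i, A a i i = 0 := fun a i => by linarith [hA a i i]
  obtain ⟨b0, b1, b2, b3, b4, b5, b6, b7⟩ := dependent_components hA hAc hAt
  obtain rfl | rfl | rfl | rfl : k = 0 ∨ k = 1 ∨ k = 2 ∨ k = 3 := by omega
  all_goals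
    simp only [curvatureTerm, frameCommutator, kulkarniNomizu, ricciTerm, minkowski,
      Fin.sum_univ_four, minkowskiSign, Fin.isValue, if_true, one_ne_zero, zero_ne_one, if_false,
      Fin.reduceEq, zero_mul, mul_zero, add_zero, zero_add, sub_zero, zero_sub, mul_one, one_mul,
      neg_zero, sub_self,
      hP 1 0, hP 2 0, hP 3 0, hP 2 1, hP 3 1, hP 3 2, hF0, hA0, hF 1 0, hF 2 0, hF 3 0, hF 2 1,
      hF 3 1, hF 3 2, hA _ 1 0, hA _ 2 0, hA _ 3 0, hA _ 2 1, hA _ 3 1, hA _ 3 2]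
    simp only [b0, b1, b2, b3, b4, b5, b6, b7]
    ring

set_option maxHeartbeats 1000000 in
-- For the metric part, the cyclic identity reduces every surviving term to a multiple of `F_{ef}
-- A_k^{ef}`, with coefficients `1 - 2 - 1 + 2 = 0`. The energy-momentum part is cubic in `F` and
-- linear in `A` and cancels in components once the dependent components of `A` are eliminated.
theorem ricciTerm_emTensor {F : Fin 4 → Fin 4 → ℝ} {A : Fin 4 → Fin 4 → Fin 4 → ℝ}
    (hF : ∀ a b, F a b = - F b a) (hA : ∀ a b c, A a b c = - A a c b)
    (hAc : ∀ a b c, A a b c + A b c a + A c a b = 0)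
    (hAt : ∀ c, ∑ a, minkowskiSign a * A a a c = 0) (r s : ℝ) (k : Fin 4) :
    ricciTerm (fun i j => r * minkowski i j + s * frameEmTensor F i j) F A k = 0 := by
  have hF0 : ∀ i, F i i = 0 := fun i => by linarith [hF i i]
  have hA0 : ∀ a i, A a i i = 0 := fun a i => by linarith [hA a i i]
  obtain ⟨b0, b1, b2, b3, b4, b5, b6, b7⟩ := dependent_components hA hAc hAt
  obtain rfl | rfl | rfl | rfl : k = 0 ∨ k = 1 ∨ k = 2 ∨ k = 3 := by omega
  all_goals
    simp only [frameEmTensor, ricciTerm, minkowski,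
      Fin.sum_univ_four, minkowskiSign, Fin.isValue, if_true, one_ne_zero, zero_ne_one, if_false,
      Fin.reduceEq, zero_mul, mul_zero, add_zero, zero_add, sub_zero, zero_sub, mul_one, one_mul,
      neg_zero, sub_self,
      hF0, hA0, hF 1 0, hF 2 0, hF 3 0, hF 2 1, hF 3 1, hF 3 2, hA _ 1 0, hA _ 2 0, hA _ 3 0,
      hA _ 2 1, hA _ 3 1, hA _ 3 2]
    simp only [b0, b1, b2, b3, b4, b5, b6, b7]
    ring

end FrameAlgebra

/-! ### Reduction of the divergence to curvature terms, and their vanishing. -/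

section FrameDivergence

/-- The covariant derivative of `A_{eaf} A^e_b^f` in an orthonormal frame, when `B = ∇A`. -/
def frameNablaOuter (A : Fin 4 → Fin 4 → Fin 4 → ℝ) (B : Fin 4 → Fin 4 → Fin 4 → Fin 4 → ℝ)
    (c a b : Fin 4) : ℝ :=
  ∑ e, ∑ f, minkowskiSign e * minkowskiSign f * (B c e a f * A e b f + A e a f * B c e b f)

variable {A : Fin 4 → Fin 4 → Fin 4 → ℝ} {B : Fin 4 → Fin 4 → Fin 4 → Fin 4 → ℝ}

/-- Contraction with the antisymmetric `X` sees only the antisymmetric part of `Y`, which is `½ Z`.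
-/
theorem sum_antisymm_mul_cyclic {X Y : Fin 4 → Fin 4 → ℝ} {Z : Fin 4 → Fin 4 → ℝ}
    (hX : ∀ a f, X a f = - X f a) (h : ∀ a f, Y a f - Y f a = Z a f) :
    ∑ a, ∑ f, minkowskiSign a * minkowskiSign f * (X a f * (Y a f - (1 / 2) * Z a f)) = 0 := by
  have h1 : ∑ a, ∑ f, minkowskiSign a * minkowskiSign f * (X a f * (Y a f - (1 / 2) * Z a f)) =
      (1 / 2) * ∑ a, ∑ f, minkowskiSign a * minkowskiSign f * (X a f * (Y a f + Y f a)) := by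
    simp only [Finset.mul_sum, ← h]
    exact Finset.sum_congr rfl fun a _ => Finset.sum_congr rfl fun f _ => by ring
  have h2 : ∑ a, ∑ f, minkowskiSign a * minkowskiSign f * (X a f * (Y a f + Y f a)) =
      - ∑ a, ∑ f, minkowskiSign a * minkowskiSign f * (X a f * (Y a f + Y f a)) := by
    conv_lhs => rw [Finset.sum_comm]
    simp only [← Finset.sum_neg_distrib]
    exact Finset.sum_congr rfl fun a _ => Finset.sum_congr rfl fun f _ => by rw [hX f a]; ring
  rw [h1]; linarith

/-- The derivative index of `∇A` is exchanged with the first index of `A` in each term. After the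
exchange one term is a trace of `B`, and the other two cancel by the cyclic identity; the
commutators make up the right side. -/
theorem frame_divergence
    {R : Fin 4 → Fin 4 → Fin 4 → Fin 4 → ℝ} {F : Fin 4 → Fin 4 → ℝ}
    (hA : ∀ a b c, A a b c = - A a c b) (hB : ∀ d a b c, B d a b c = - B d a c b)
    (hBc : ∀ d a b c, B d a b c + B d b c a + B d c a b = 0)
    (hBt : ∀ d c, ∑ a, minkowskiSign a * B d a a c = 0)
    (hR : ∀ a e b f, B a e b f - B e a b f = frameCommutator R F a e b f) (k : Fin 4) :
    (∑ i, minkowskiSign i * frameNablaOuter A B i i k)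
      - (1 / 4) * (∑ i, minkowskiSign i * frameNablaOuter A B k i i) = curvatureTerm R F A k := by
  have e1 : ∑ a, ∑ e, ∑ f, minkowskiSign a * minkowskiSign e * minkowskiSign f *
      (A e k f * B e a a f) = 0 := by
    rw [Finset.sum_comm]
    refine Finset.sum_eq_zero fun e _ => ?_
    rw [Finset.sum_comm]
    refine Finset.sum_eq_zero fun f _ => ?_
    rw [← mul_zero (minkowskiSign e * minkowskiSign f * A e k f), ← hBt e f, Finset.mul_sum]
    exact Finset.sum_congr rfl fun a _ => by ring
  have e2 : ∑ a, ∑ e, ∑ f, minkowskiSign a * minkowskiSign e * minkowskiSign f *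
      (A e a f * (B e a k f - (1 / 2) * B e k a f)) = 0 := by
    rw [Finset.sum_comm]
    refine Finset.sum_eq_zero fun e _ => ?_
    -- The cyclic identity gives `B_{eakf} - B_{efka} = B_{ekaf}`.
    have h := sum_antisymm_mul_cyclic (X := A e) (Y := fun a f => B e a k f)
      (Z := fun a f => B e k a f) (hA e) fun a f => by
        linear_combination hBc e a k f - hB e f k a - hB e k f a
    rw [← mul_zero (minkowskiSign e), ← h, Finset.mul_sum]
    refine Finset.sum_congr rfl fun a _ => ?_
    rw [Finset.mul_sum]
    exact Finset.sum_congr rfl fun f _ => by ring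
  have e3 : (∑ i, minkowskiSign i * frameNablaOuter A B i i k)
      - (1 / 4) * (∑ i, minkowskiSign i * frameNablaOuter A B k i i) =
      ∑ a, ∑ e, ∑ f, minkowskiSign a * minkowskiSign e * minkowskiSign f *
        (B a e a f * A e k f + A e a f * B a e k f - (1 / 2) * (A e a f * B k e a f)) := by
    simp only [frameNablaOuter, Finset.mul_sum, ← Finset.sum_sub_distrib]
    exact Finset.sum_congr rfl fun a _ => Finset.sum_congr rfl fun e _ =>
      Finset.sum_congr rfl fun f _ => by ring
  have e4 : ∑ a, ∑ e, ∑ f, minkowskiSign a * minkowskiSign e * minkowskiSign f *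
        (B a e a f * A e k f + A e a f * B a e k f - (1 / 2) * (A e a f * B k e a f))
      - curvatureTerm R F A k =
      (∑ a, ∑ e, ∑ f, minkowskiSign a * minkowskiSign e * minkowskiSign f *
        (A e k f * B e a a f)) +
      ∑ a, ∑ e, ∑ f, minkowskiSign a * minkowskiSign e * minkowskiSign f *
        (A e a f * (B e a k f - (1 / 2) * B e k a f)) := by
    simp only [curvatureTerm, ← hR, ← Finset.sum_sub_distrib, ← Finset.sum_add_distrib]
    exact Finset.sum_congr rfl fun a _ => Finset.sum_congr rfl fun e _ =>
      Finset.sum_congr rfl fun f _ => by ring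
  rw [e3]; linarith

theorem kulkarniNomizu_trace (P : Fin 4 → Fin 4 → ℝ) (a b : Fin 4) :
    ∑ c, minkowskiSign c * kulkarniNomizu P c a c b =
      2 * P a b + minkowski a b * ∑ c, minkowskiSign c * P c c := by
  obtain rfl | rfl | rfl | rfl : a = 0 ∨ a = 1 ∨ a = 2 ∨ a = 3 := by omega
  all_goals
    obtain rfl | rfl | rfl | rfl : b = 0 ∨ b = 1 ∨ b = 2 ∨ b = 3 := by omega
    all_goals
      simp [kulkarniNomizu, minkowski, minkowskiSign, Fin.sum_univ_four]
      try ring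

theorem minkowski_symm (i j : Fin 4) : minkowski i j = minkowski j i := by
  by_cases h : i = j
  · rw [h]
  · simp [minkowski, h, Ne.symm h]

theorem frameEmTensor_symm (F : Fin 4 → Fin 4 → ℝ) (i j : Fin 4) :
    frameEmTensor F i j = frameEmTensor F j i := by
  simp only [frameEmTensor, minkowski_symm i j, mul_comm (F i _)]

theorem minkowskiSign_mul_self (i : Fin 4) : minkowskiSign i * minkowskiSign i = 1 := by
  by_cases h : i = 0 <;> simp [minkowskiSign, h]

theorem trace_minkowski : ∑ i, minkowskiSign i * minkowski i i = 4 := by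
  simp [minkowski, minkowskiSign_mul_self]

theorem trace_frameEmTensor (F : Fin 4 → Fin 4 → ℝ) :
    ∑ i, minkowskiSign i * frameEmTensor F i i = 0 := by
  have h : ∀ i, minkowskiSign i * frameEmTensor F i i =
      - (∑ d, minkowskiSign i * minkowskiSign d * (F i d * F i d))
      + (1 / 4) * (minkowskiSign i * minkowski i i) *
        ∑ c, ∑ d, minkowskiSign c * minkowskiSign d * (F c d * F c d) := by
    intro i
    have : ∑ d, minkowskiSign i * minkowskiSign d * (F i d * F i d) =
        minkowskiSign i * ∑ d, minkowskiSign d * (F i d * F i d) := by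
      rw [Finset.mul_sum]; exact Finset.sum_congr rfl fun d _ => by ring
    rw [frameEmTensor, this]; ring
  simp only [h, Finset.sum_add_distrib, Finset.sum_neg_distrib, ← Finset.sum_mul,
    ← Finset.mul_sum, trace_minkowski]
  ring

theorem kulkarniNomizu_antisymm_left (P : Fin 4 → Fin 4 → ℝ) (a b c d : Fin 4) :
    kulkarniNomizu P a b c d = - kulkarniNomizu P b a c d := by
  simp only [kulkarniNomizu]; ring

theorem kulkarniNomizu_antisymm_right (P : Fin 4 → Fin 4 → ℝ) (a b c d : Fin 4) :
    kulkarniNomizu P a b c d = - kulkarniNomizu P a b d c := by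
  simp only [kulkarniNomizu]; ring

theorem kulkarniNomizu_cyclic {P : Fin 4 → Fin 4 → ℝ} (hP : ∀ a b, P a b = P b a)
    (a b c d : Fin 4) :
    kulkarniNomizu P a b c d + kulkarniNomizu P a c d b + kulkarniNomizu P a d b c = 0 := by
  simp only [kulkarniNomizu, hP c b, hP d b, hP d c, minkowski_symm c b, minkowski_symm d b,
    minkowski_symm d c]
  ring

/-- The classical argument: a combination of the four cyclic identities with different leading
index, reduced by the two antisymmetries. -/
theorem pair_symm_of_cyclic {R : Fin 4 → Fin 4 → Fin 4 → Fin 4 → ℝ}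
    (hl : ∀ a b c d, R a b c d = - R b a c d) (hr : ∀ a b c d, R a b c d = - R a b d c)
    (hc : ∀ a b c d, R a b c d + R a c d b + R a d b c = 0) (a b c d : Fin 4) :
    R a b c d = R c d a b := by
  linarith [hc a b c d, hc b c d a, hc c d a b, hc d a b c, hl a b c d, hl a c d b, hl a d b c,
    hr a b c d, hr a c d b, hr a d b c, hl b c d a, hr b c d a, hl b d a c, hr b d a c,
    hl c d a b, hr c d a b, hl d a b c, hr d a b c, hl c a b d, hr c a b d, hl d b c a, hr d b c a,
    hl c b d a, hr c b d a, hl d c a b, hr d c a b, hl b a c d, hr b a c d, hr d c b a, hr c a d b]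

/-- The curvature terms in the divergence vanish in dimension four if the Ricci tensor is a
combination of the metric and the energy-momentum tensor. -/
theorem curvatureTerm_eq_zero {R : Fin 4 → Fin 4 → Fin 4 → Fin 4 → ℝ} {F : Fin 4 → Fin 4 → ℝ}
    (hl : ∀ a b c d, R a b c d = - R b a c d) (hr : ∀ a b c d, R a b c d = - R a b d c)
    (hc : ∀ a b c d, R a b c d + R a c d b + R a d b c = 0) {r s : ℝ}
    (ht : ∀ a b, ∑ c, minkowskiSign c * R c a c b = r * minkowski a b + s * frameEmTensor F a b)
    (hF : ∀ a b, F a b = - F b a) (hA : ∀ a b c, A a b c = - A a c b)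
    (hAc : ∀ a b c, A a b c + A b c a + A c a b = 0)
    (hAt : ∀ c, ∑ a, minkowskiSign a * A a a c = 0) (k : Fin 4) :
    curvatureTerm R F A k = 0 := by
  -- The Kulkarni-Nomizu product of `P` has Ricci contraction `2P + η tr P`. As `T` is trace-free,
  -- `tr P = 2r/3`, so the coefficients `r/6` and `s/2` reproduce `rη + sT` and make the remainder
  -- `W` trace-free.
  let P : Fin 4 → Fin 4 → ℝ := fun i j => r / 6 * minkowski i j + s / 2 * frameEmTensor F i j
  have hP : ∀ i j, P i j = P j i := fun i j => by
    simp only [P, minkowski_symm i j, frameEmTensor_symm F i j]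
  have hPt : ∑ c, minkowskiSign c * P c c = 2 * r / 3 := by
    have : ∀ c, minkowskiSign c * P c c = r / 6 * (minkowskiSign c * minkowski c c)
        + s / 2 * (minkowskiSign c * frameEmTensor F c c) := fun c => by simp only [P]; ring
    simp only [this, Finset.sum_add_distrib, ← Finset.mul_sum, trace_minkowski,
      trace_frameEmTensor]
    ring
  let W : Fin 4 → Fin 4 → Fin 4 → Fin 4 → ℝ := fun a b c d => R a b c d - kulkarniNomizu P a b c d
  have wl : ∀ a b c d, W a b c d = - W b a c d := fun a b c d => by
    simp only [W]; linarith [hl a b c d, kulkarniNomizu_antisymm_left P a b c d]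
  have wr : ∀ a b c d, W a b c d = - W a b d c := fun a b c d => by
    simp only [W]; linarith [hr a b c d, kulkarniNomizu_antisymm_right P a b c d]
  have wc : ∀ a b c d, W a b c d + W a c d b + W a d b c = 0 := fun a b c d => by
    simp only [W]; linarith [hc a b c d, kulkarniNomizu_cyclic hP a b c d]
  have wt : ∀ a b, ∑ c, minkowskiSign c * W c a c b = 0 := fun a b => by
    simp only [W, mul_sub, Finset.sum_sub_distrib, ht, kulkarniNomizu_trace, hPt, P]
    ring
  have h0 := curvatureTerm_weyl wl wr (pair_symm_of_cyclic wl wr wc) wc wt hF hA hAc hAt k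
  have h1 := (curvatureTerm_kulkarniNomizu hP hF hA hAc hAt k).trans
    (ricciTerm_emTensor hF hA hAc hAt (r / 6) (s / 2) k)
  have hcomm : ∀ a e b f, frameCommutator R F a e b f =
      frameCommutator W F a e b f + frameCommutator (kulkarniNomizu P) F a e b f := by
    intro a e b f
    simp only [frameCommutator, W, ← Finset.sum_add_distrib, ← Finset.sum_neg_distrib]
    exact Finset.sum_congr rfl fun d _ => by ring
  have hsum : curvatureTerm R F A k =
      curvatureTerm W F A k + curvatureTerm (kulkarniNomizu P) F A k := by
    simp only [curvatureTerm, hcomm, ← Finset.sum_add_distrib]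
    exact Finset.sum_congr rfl fun a _ => Finset.sum_congr rfl fun e _ =>
      Finset.sum_congr rfl fun f _ => by ring
  rw [hsum, h0, h1, add_zero]

end FrameDivergence

/-! ### Transfer of contractions and symmetries from coordinates to a frame. -/

section FrameTransformation

variable {E : Fin 4 → Fin 4 → ℝ} {G : Fin 4 → Fin 4 → ℝ}

theorem toFrame4_antisymm_left {R : Fin 4 → Fin 4 → Fin 4 → Fin 4 → ℝ}
    (h : ∀ a b c d, R a b c d = - R b a c d) (i j k l : Fin 4) :
    toFrame4 E R i j k l = - toFrame4 E R j i k l := by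
  rw [toFrame4_swap12]
  simp only [toFrame4, toFrame3, toFrame2, ← toFrame1_neg, ← h]

theorem toFrame4_antisymm_right {R : Fin 4 → Fin 4 → Fin 4 → Fin 4 → ℝ}
    (h : ∀ a b c d, R a b c d = - R a b d c) (i j k l : Fin 4) :
    toFrame4 E R i j k l = - toFrame4 E R i j l k := by
  simp only [toFrame4, ← toFrame1_neg]
  congr 1; funext a
  exact toFrame3_antisymm E (h a) j k l

theorem toFrame4_cyclic {R : Fin 4 → Fin 4 → Fin 4 → Fin 4 → ℝ}
    (h : ∀ a b c d, R a b c d + R a c d b + R a d b c = 0) (i j k l : Fin 4) :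
    toFrame4 E R i j k l + toFrame4 E R i k l j + toFrame4 E R i l j k = 0 := by
  simp only [toFrame4, ← toFrame1_add, toFrame3_cyclic E (h _), toFrame1_zero]

theorem toFrame4_permute (R : Fin 4 → Fin 4 → Fin 4 → Fin 4 → ℝ) (i j k m : Fin 4) :
    toFrame4 E (fun c e a d => R d a c e) i j k m = toFrame4 E R m k i j := by
  conv_lhs => rw [toFrame4_swap34, toFrame4_swap23, toFrame4_swap12, toFrame4_swap34,
    toFrame4_swap23]

variable (hG : ∀ a b, G a b = ∑ i, minkowskiSign i * E i a * E i b)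
include hG

theorem toFrame4_commutator {R B : Fin 4 → Fin 4 → Fin 4 → Fin 4 → ℝ} {F : Fin 4 → Fin 4 → ℝ}
    (h : ∀ c e a b, B c e a b - B e c a b =
      - ((∑ d, ∑ d', G d d' * (F d b * R d' a c e)) + ∑ d, ∑ d', G d d' * (F a d * R d' b c e)))
    (i j k l : Fin 4) : toFrame4 E B i j k l - toFrame4 E B j i k l =
      frameCommutator (toFrame4 E R) (toFrame2 E F) i j k l := by
  rw [toFrame4_swap12 E B j i]
  simp only [toFrame4, toFrame3, toFrame2, ← toFrame1_sub, h]
  simp only [contract_mul_eq_frame hG, ← Finset.sum_add_distrib, toFrame1_neg, toFrame1_sum,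
    toFrame1_add, toFrame1_const_mul, toFrame1_mul_const, frameCommutator]
  congr 1
  refine Finset.sum_congr rfl fun m _ => ?_
  have h1 := toFrame4_permute (E := E) R i j k m
  have h2 := toFrame4_permute (E := E) R i j l m
  have h3 := toFrame2_swap E F m l
  simp only [toFrame4, toFrame3, toFrame2] at h1 h2 h3
  rw [h1, h2, ← h3]
  simp only [toFrame4, toFrame3, toFrame2]
  ring

theorem toFrame2_ricci (R : Fin 4 → Fin 4 → Fin 4 → Fin 4 → ℝ) (i j : Fin 4) :
    toFrame2 E (fun a b => ∑ c, ∑ d, G c d * R d a c b) i j =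
      ∑ m, minkowskiSign m * toFrame4 E R m i m j := by
  have h : ∀ m, toFrame4 E R m i m j = toFrame4 E (fun c d a b => R d a c b) m m i j := by
    intro m
    conv_rhs => rw [toFrame4_swap12, toFrame4_swap23]
  simp only [h]
  refine Eq.trans ?_ (contract_eq_frame hG fun c d => toFrame2 E (fun a b => R d a c b) i j)
  simp only [toFrame2, toFrame1_sum, toFrame1_const_mul]

theorem toFrame2_emTensor {g : Fin 4 → Fin 4 → ℝ} (hE : ∀ i j, toFrame2 E g i j = minkowski i j)
    (F : Fin 4 → Fin 4 → ℝ) (i j : Fin 4) :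
    toFrame2 E (fun a b => - (∑ c, ∑ c', G c c' * F a c * F b c')
      + (1 / 4) * g a b * ∑ c, ∑ c', ∑ d, ∑ d', G c c' * G d d' * F c d * F c' d') i j =
      frameEmTensor (toFrame2 E F) i j := by
  have h1 := fun a b => contract_mul_eq_frame hG (F a) (F b)
  have h2 := contract2_mul_eq_frame hG F F
  simp only [mul_assoc] at h1 h2 ⊢
  simp only [h1, h2, frameEmTensor, ← hE, mul_assoc]
  simp only [toFrame2, toFrame1_add, toFrame1_neg, toFrame1_sum, toFrame1_const_mul,
    toFrame1_mul_const]

theorem toFrame3_nablaOuter (A : Fin 4 → Fin 4 → Fin 4 → ℝ)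
    (B : Fin 4 → Fin 4 → Fin 4 → Fin 4 → ℝ) (i j k : Fin 4) :
    toFrame3 E (fun c a b => ∑ e, ∑ e', ∑ f, ∑ f', G e e' * G f f' *
      (B c e a f * A e' b f' + A e a f * B c e' b f')) i j k =
      frameNablaOuter (toFrame3 E A) (toFrame4 E B) i j k := by
  have h1 := fun c a b => contract2_mul_eq_frame hG (fun e f => B c e a f) (fun e f => A e b f)
  have h2 := fun c a b => contract2_mul_eq_frame hG (fun e f => A e a f) (fun e f => B c e b f)
  simp only [mul_add, Finset.sum_add_distrib, h1, h2, frameNablaOuter]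
  have hA : ∀ k m n, toFrame1 E (fun b => toFrame2 E (fun e f => A e b f) m n) k =
      toFrame3 E A m k n := fun k m n => (toFrame3_swap_left E A m k n).symm
  have hB : ∀ j m n, toFrame1 E (fun c => toFrame1 E (fun a =>
      toFrame2 E (fun e f => B c e a f) m n) j) i = toFrame4 E B i m j n :=
    fun j m n => (toFrame4_swap23 E B i m j n).symm
  rw [toFrame3]
  simp only [toFrame2] at hA hB ⊢
  simp only [toFrame1_add, toFrame1_sum, toFrame1_const_mul, toFrame1_mul_const, hA, hB]

theorem toFrame1_divergence (N : Fin 4 → Fin 4 → Fin 4 → ℝ) (k : Fin 4) :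
    toFrame1 E (fun b => (∑ a, ∑ a', G a a' * N a' a b)
      - (1 / 4) * ∑ p, ∑ q, G p q * N b p q) k =
      (∑ i, minkowskiSign i * toFrame3 E N i i k)
        - (1 / 4) * ∑ i, minkowskiSign i * toFrame3 E N k i i := by
  have h1 : ∀ b, ∑ a, ∑ a', G a a' * N a' a b =
      ∑ i, minkowskiSign i * toFrame2 E (fun a a' => N a' a b) i i :=
    fun b => contract_eq_frame hG fun a a' => N a' a b
  have h2 : ∀ i, toFrame1 E (fun b => toFrame2 E (fun a a' => N a' a b) i i) k =
      toFrame3 E N i i k := by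
    intro i
    conv_rhs => rw [toFrame3_swap_right, toFrame3_swap_left, toFrame3_swap_right]
    rfl
  simp only [h1, contract_eq_frame hG, toFrame1_sub, toFrame1_const_mul, toFrame1_sum, h2]
  rfl

end FrameTransformation

/-! ### Vanishing of the divergence in a coordinate domain. -/

section LocalDivergence

variable {g : Comp2} {U : Set R4} {y : R4}

/-- From `E g Eᵀ = η` and `η² = 1` it follows that `(Eᵀ η E) g = 1`, because one-sided inverses of
square matrices are two-sided. -/
theorem ginv_eq_frame {E : Fin 4 → Fin 4 → ℝ}
    (hE : ∀ i j, toFrame2 E (fun a b => g a b y) i j = minkowski i j) :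
    IsUnit (valueMatrix g y).det ∧
      ∀ a b, ginv g a b y = ∑ i, minkowskiSign i * E i a * E i b := by
  let M : Matrix (Fin 4) (Fin 4) ℝ := Matrix.of E
  let η : Matrix (Fin 4) (Fin 4) ℝ := Matrix.diagonal minkowskiSign
  have h1 : M * valueMatrix g y * M.transpose = η := by
    ext i j
    have : η i j = minkowski i j := by
      by_cases h : i = j <;> simp [η, minkowski, h]
    rw [this, ← hE]
    simp only [Matrix.mul_apply, toFrame2, toFrame1, valueMatrix, M, Matrix.of_apply,
      Matrix.transpose_apply, Finset.mul_sum, Finset.sum_mul]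
    rw [Finset.sum_comm]
    exact Finset.sum_congr rfl fun a _ => Finset.sum_congr rfl fun b _ => by ring
  have h2 : η * η = 1 := by
    simp only [η, Matrix.diagonal_mul_diagonal, minkowskiSign_mul_self, Matrix.diagonal_one]
  have h3 : (η * M * valueMatrix g y) * M.transpose = 1 := by
    rw [Matrix.mul_assoc, Matrix.mul_assoc, ← Matrix.mul_assoc M, h1, h2]
  have h4 : (M.transpose * η * M) * valueMatrix g y = 1 := by
    rw [← mul_eq_one_comm.mp h3]; simp only [Matrix.mul_assoc]
  refine ⟨Matrix.isUnit_det_of_left_inverse h4, fun a b => ?_⟩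
  change (valueMatrix g y)⁻¹ a b = _
  rw [Matrix.inv_eq_left_inv h4, Matrix.mul_apply]
  simp only [η, M, Matrix.mul_diagonal, Matrix.transpose_apply, Matrix.of_apply]
  exact Finset.sum_congr rfl fun i _ => by ring

namespace IsMetricOn

variable (hg : IsMetricOn g U)
include hg

/-- The frame components determine `g⁻¹ X`, hence `X = g (g⁻¹ X)`; a covector equation may thus be
checked in the frame. -/
theorem eq_zero_of_toFrame1 (hy : y ∈ U) {E : Fin 4 → Fin 4 → ℝ}
    (hG : ∀ a b, ginv g a b y = ∑ i, minkowskiSign i * E i a * E i b) {X : Fin 4 → ℝ}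
    (h : ∀ k, toFrame1 E X k = 0) (b : Fin 4) : X b = 0 := by
  have h0 : (valueMatrix (ginv g) y).mulVec X = 0 := by
    funext a
    simp only [Matrix.mulVec, dotProduct, valueMatrix, Matrix.of_apply, hG, Finset.sum_mul,
      Pi.zero_apply]
    rw [Finset.sum_comm]
    refine Finset.sum_eq_zero fun i _ => ?_
    rw [← mul_zero (minkowskiSign i * E i a), ← h i, toFrame1, Finset.mul_sum]
    exact Finset.sum_congr rfl fun b _ => by ring
  have h1 : (valueMatrix g y).mulVec ((valueMatrix (ginv g) y).mulVec X) = X := by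
    rw [Matrix.mulVec_mulVec, hg.mul_ginv hy, Matrix.one_mulVec]
  rw [← congrFun h1 b, h0, Matrix.mulVec_zero, Pi.zero_apply]

/-- The Ricci tensor of a solution of the Einstein-Maxwell equations. -/
theorem ricci_of_einsteinMaxwell (hy : y ∈ U) {E : Fin 4 → Fin 4 → ℝ}
    (hE : ∀ i j, toFrame2 E (fun a b => g a b y) i j = minkowski i j) {F : Comp2} {κ Λ : ℝ}
    (h : ∀ a b, ricci g a b y - (1 / 2) * scalarCurv g y * g a b y + Λ * g a b y =
      κ * emTensor g F a b y) (a b : Fin 4) :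
    ricci g a b y = Λ * g a b y + κ * emTensor g F a b y := by
  have hG := (ginv_eq_frame hE).2
  have h0 : ∑ a, ∑ b, ginv g a b y * emTensor g F a b y = 0 := by
    rw [contract_eq_frame hG, ← trace_frameEmTensor (toFrame2 E fun a b => F a b y)]
    simp only [← toFrame2_emTensor hG hE]
    rfl
  have h1 : ∀ a b, ginv g a b y * ricci g a b y =
      (1 / 2 * scalarCurv g y - Λ) * (ginv g a b y * g a b y)
        + κ * (ginv g a b y * emTensor g F a b y) := by
    intro a b; linear_combination ginv g a b y * h a b
  -- The trace of the field equations, with `T` trace-free and dimension four; it forces `R = 4Λ`.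
  have h2 : scalarCurv g y = (1 / 2 * scalarCurv g y - Λ) * 4 := by
    conv_lhs => rw [scalarCurv]
    simp only [h1, Finset.sum_add_distrib, ← Finset.mul_sum, h0, hg.trace_metric hy]
    ring
  have h3 : scalarCurv g y = 4 * Λ := by linarith
  have := h a b
  rw [h3] at this
  linarith

theorem div2_traceFreeOuter (hy : y ∈ U) {E : Fin 4 → Fin 4 → ℝ}
    (hE : ∀ i j, toFrame2 E (fun a b => g a b y) i j = minkowski i j)
    {F : Comp2} (hF : ∀ a b, ContDiffOn ℝ ∞ (F a b) U)
    (hanti : ∀ x ∈ U, ∀ a b, F a b x = - F b a x)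
    (hdiv : ∀ x ∈ U, ∀ b, div2 g F b x = 0)
    (hcyc : ∀ x ∈ U, ∀ a b c,
      nabla2 g F a b c x + nabla2 g F b c a x + nabla2 g F c a b x = 0) {r s : ℝ}
    (hric : ∀ a b, ricci g a b y = r * g a b y + s * emTensor g F a b y) (b : Fin 4) :
    div2 g (traceFreeOuter g (nabla2 g F)) b y = 0 := by
  have hU := hg.isOpen
  have hG := (ginv_eq_frame hE).2
  have hA := hg.smooth_nabla2 hF
  have hAa : ∀ x ∈ U, ∀ e a b, nabla2 g F e a b x = - nabla2 g F e b a x :=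
    fun x hx e a b => nabla2_antisymm hU hanti hx e a b
  have hAt : ∀ x ∈ U, ∀ c, ∑ a, ∑ b, ginv g a b x * nabla2 g F a b c x = 0 := by
    intro x hx c
    rw [hg.sum_ginv_swap hx, ← hdiv x hx c]; rfl
  let A₀ : Fin 4 → Fin 4 → Fin 4 → ℝ := fun a b c => nabla2 g F a b c y
  let B₀ : Fin 4 → Fin 4 → Fin 4 → Fin 4 → ℝ := fun d a b c => nabla3 g (nabla2 g F) d a b c y
  let R₀ : Fin 4 → Fin 4 → Fin 4 → Fin 4 → ℝ := fun d c a b => lowerRiemann g d c a b y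
  let F₀ : Fin 4 → Fin 4 → ℝ := fun a b => F a b y
  let N₀ : Fin 4 → Fin 4 → Fin 4 → ℝ := fun c a b => nabla2 g (contractOuter g (nabla2 g F)) c a b y
  have hdivN : ∀ b, div2 g (traceFreeOuter g (nabla2 g F)) b y =
      (∑ a, ∑ a', ginv g a a' y * N₀ a' a b)
        - (1 / 4) * ∑ p, ∑ q, ginv g p q y * N₀ b p q := by
    intro b
    let t : Fin 4 → ℝ := fun c => ∑ p, ∑ q, ginv g p q y * N₀ c p q
    have h : ∀ a a', ginv g a a' y * nabla2 g (traceFreeOuter g (nabla2 g F)) a' a b y =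
        ginv g a a' y * N₀ a' a b - (1 / 4) * (ginv g a a' y *
          (g b a y * t a')) := by
      intro a a'
      rw [hg.nabla2_traceFreeOuter hA hy, hg.symm y hy a b]
      simp only [t, N₀]; ring
    -- The divergence of `g_{ab}` times a scalar is the gradient of that scalar, here the trace of
    -- `N₀` over its last two indices.
    simp only [div2, h, Finset.sum_sub_distrib, ← Finset.mul_sum]
    rw [hg.ginv_metric_contract hy b t]
  have hN : N₀ = fun c a b => ∑ e, ∑ e', ∑ f, ∑ f', ginv g e e' y * ginv g f f' y *
      (B₀ c e a f * A₀ e' b f' + A₀ e a f * B₀ c e' b f') := by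
    funext c a b; exact hg.nabla2_contractOuter hA hy c a b
  have hcomm : ∀ c e a b, B₀ c e a b - B₀ e c a b =
      - ((∑ d, ∑ d', ginv g d d' y * (F₀ d b * R₀ d' a c e))
        + ∑ d, ∑ d', ginv g d d' y * (F₀ a d * R₀ d' b c e)) := by
    intro c e a b
    refine (hg.ricci_identity hF hy c e a b).trans ?_
    simp only [hg.riemann_eq hy, Finset.sum_mul]
    rw [neg_add, ← sub_eq_add_neg]
    congr 1
    · congr 1
      exact Finset.sum_congr rfl fun d _ => Finset.sum_congr rfl fun d' _ => by
        simp only [F₀, R₀]; ring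
    · exact Finset.sum_congr rfl fun d _ => Finset.sum_congr rfl fun d' _ => by
        simp only [F₀, R₀]; ring
  have hricF : ∀ i j, ∑ c, minkowskiSign c * toFrame4 E R₀ c i c j =
      r * minkowski i j + s * frameEmTensor (toFrame2 E F₀) i j := by
    intro i j
    have hem : toFrame2 E (fun a b => emTensor g F a b y) i j =
        frameEmTensor (toFrame2 E F₀) i j := toFrame2_emTensor hG hE F₀ i j
    rw [← toFrame2_ricci hG R₀, ← hem, ← hE]
    have : (fun a b => ∑ c, ∑ d, ginv g c d y * R₀ d a c b) =
        fun a b => r * g a b y + s * emTensor g F a b y := by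
      funext a b; rw [← hric, hg.ricci_eq hy]
    rw [this]
    simp only [toFrame2, toFrame1_add, toFrame1_const_mul]
  have hR := toFrame4_commutator hG hcomm
  have hFF : ∀ i j, toFrame2 E F₀ i j = - toFrame2 E F₀ j i := by
    intro i j
    rw [toFrame2_swap]
    simp only [toFrame2, ← toFrame1_neg]
    simp only [F₀, ← hanti y hy]
  have hAF := toFrame3_antisymm E (X := A₀) (hAa y hy)
  have hAcF := toFrame3_cyclic E (X := A₀) (hcyc y hy)
  have hAtF := frame_trace_zero hG (X := A₀) (hAt y hy)
  have hBF := toFrame4_antisymm_right (E := E) (R := B₀)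
    fun d a b c => nabla3_antisymm hU hAa hy d a b c
  have hBcF := toFrame4_cyclic (E := E) (R := B₀) fun d a b c => hg.nabla3_cyclic hA hcyc hy d a b c
  have hBtF : ∀ l k, ∑ i, minkowskiSign i * toFrame4 E B₀ l i i k = 0 := by
    intro l k
    have := fun d => frame_trace_zero hG (X := B₀ d)
      (fun b => hg.nabla3_traceFree hA hAt hy d b) k
    simp only [toFrame4, ← toFrame1_const_mul, ← toFrame1_sum, this, toFrame1_zero]
  refine hg.eq_zero_of_toFrame1 hy hG (X := fun b => div2 g (traceFreeOuter g (nabla2 g F)) b y)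
    (fun k => ?_) b
  simp only [hdivN]
  rw [toFrame1_divergence hG N₀]
  have hNF := toFrame3_nablaOuter hG A₀ B₀
  rw [← hN] at hNF
  simp only [hNF]
  rw [frame_divergence hAF hBF hBcF hBtF hR k]
  exact curvatureTerm_eq_zero
    (toFrame4_antisymm_left fun d c a b => hg.lowerRiemann_antisymm_left hy d c a b)
    (toFrame4_antisymm_right fun d c a b => lowerRiemann_antisymm_right g d c a b y)
    (toFrame4_cyclic fun d a b c => hg.lowerRiemann_cyclic hy d a b c)
    hricF hFF hAF hAcF hAtF k

end IsMetricOn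

end LocalDivergence

theorem linearMap_apply_eq_sum {V : Type*} [AddCommGroup V] [Module ℝ V] (L : R4 →ₗ[ℝ] V) (w : R4) :
    L w = ∑ a, w a • L (EuclideanSpace.single a (1 : ℝ)) := by
  have h : w = ∑ a, w a • EuclideanSpace.single a (1 : ℝ) := by
    ext c
    simp [Pi.single_apply]
  conv_lhs => rw [h]
  simp only [map_sum, map_smul]

/-! ### From the manifold to coordinate components. -/

section Charts

variable {M : Type*} [TopologicalSpace M] [ChartedSpace R4 M]
  {φ : OpenPartialHomeomorph M R4}

theorem mdifferentiable_of_mem_maximalAtlas (hφ : φ ∈ IsManifold.maximalAtlas 𝓘(ℝ, R4) ∞ M) :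
    φ.MDifferentiable 𝓘(ℝ, R4) 𝓘(ℝ, R4) :=
  ⟨(contMDiffOn_of_mem_maximalAtlas hφ).mdifferentiableOn (by simp),
    (contMDiffOn_symm_of_mem_maximalAtlas hφ).mdifferentiableOn (by simp)⟩

/-- The coordinate components of a Lorentzian metric become the Minkowski metric in a frame. -/
theorem LorentzMetric.exists_frame (g : LorentzMetric M)
    (hφ : φ ∈ IsManifold.maximalAtlas 𝓘(ℝ, R4) ∞ M) {y : R4} (hy : y ∈ φ.target) :
    ∃ E : Fin 4 → Fin 4 → ℝ, ∀ i j,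
      toFrame2 E (fun a b => g.comp φ a b y) i j = minkowski i j := by
  obtain ⟨b, hb⟩ := g.signature (φ.symm y)
  let D := (mdifferentiable_of_mem_maximalAtlas hφ).symm.mfderiv hy
  -- The chart derivative is invertible, so an orthonormal basis of the tangent space pulls back to
  -- coordinate vectors; their entries form the frame matrix.
  let v : Fin 4 → R4 := fun i => D.symm (b i)
  have hv : ∀ i, b i = ∑ a, v i a • mfderiv 𝓘(ℝ, R4) 𝓘(ℝ, R4) φ.symm y
      (EuclideanSpace.single a (1 : ℝ)) := fun i =>
    (D.apply_symm_apply (b i)).symm.trans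
      (linearMap_apply_eq_sum (D.toLinearEquiv.toLinearMap : R4 →ₗ[ℝ] _) (v i))
  refine ⟨fun i a => v i a, fun i j => ?_⟩
  have h := hb i j
  rw [hv i, hv j] at h
  simp only [map_sum, map_smul, _root_.sum_apply, _root_.smul_apply, smul_eq_mul] at h
  rw [toFrame2_swap]
  exact h

theorem LorentzMetric.isMetricOn (g : LorentzMetric M)
    (hφ : φ ∈ IsManifold.maximalAtlas 𝓘(ℝ, R4) ∞ M) : IsMetricOn (g.comp φ) φ.target where
  isOpen := φ.open_target
  smooth := g.smooth φ hφ
  symm x _ a b := g.symm _ _ _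
  det_ne_zero x hx := by
    obtain ⟨E, hE⟩ := g.exists_frame hφ hx
    exact (ginv_eq_frame hE).1.ne_zero

end Charts

end

end Chevreton

/-! ### The theorem on the manifold. -/

open Chevreton in
theorem theorem2 {M : Type*} [TopologicalSpace M] [ChartedSpace R4 M]
    [IsManifold 𝓘(ℝ, R4) ∞ M] (g : LorentzMetric M) (F : TwoForm M)
    (hMaxwell : IsSourceFreeMaxwell g F) (κ Λ : ℝ)
    (hField : IsEinsteinMaxwell g F κ Λ ∨ IsEinsteinSpace g Λ) :
    ∀ φ ∈ IsManifold.maximalAtlas 𝓘(ℝ, R4) ∞ M, ∀ y ∈ φ.target,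
      -- `H_{ab}` is symmetric, trace-free and divergence-free
      (∀ a b, chevretonTrace (g.comp φ) (F.comp φ) a b y =
        chevretonTrace (g.comp φ) (F.comp φ) b a y) ∧
      (∑ a, ∑ b, ginv (g.comp φ) a b y * chevretonTrace (g.comp φ) (F.comp φ) a b y = 0) ∧
      (∀ b, div2 (g.comp φ) (chevretonTrace (g.comp φ) (F.comp φ)) b y = 0) ∧
      -- every trace of the divergence `∇^a H_{abcd}` vanishes
      (∀ b, ∑ c, ∑ d,
        ginv (g.comp φ) c d y * div4 (g.comp φ) (chevreton (g.comp φ) (F.comp φ)) b c d y = 0) ∧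
      (∀ c, ∑ b, ∑ d,
        ginv (g.comp φ) b d y * div4 (g.comp φ) (chevreton (g.comp φ) (F.comp φ)) b c d y = 0) ∧
      (∀ d, ∑ b, ∑ c,
        ginv (g.comp φ) b c y * div4 (g.comp φ) (chevreton (g.comp φ) (F.comp φ)) b c d y = 0) := by
  intro φ hφ y hy
  have hg := g.isMetricOn hφ
  have hU := hg.isOpen
  have hF := F.smooth φ hφ
  have hanti : ∀ x ∈ φ.target, ∀ a b, F.comp φ a b x = - F.comp φ b a x :=
    fun x _ a b => F.antisymm _ _ _
  have hA := fun x hx e a b => nabla2_antisymm (g := g.comp φ) hU hanti (y := x) hx e a b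
  have hdiv := fun x hx => (hMaxwell φ hφ x hx).1
  have hcyc := fun x hx => (hMaxwell φ hφ x hx).2
  have htr : ∀ x ∈ φ.target, ∀ c, ∑ a, ∑ b,
      ginv (g.comp φ) a b x * nabla2 (g.comp φ) (F.comp φ) a b c x = 0 := by
    intro x hx c
    rw [hg.sum_ginv_swap hx, ← hdiv x hx c]; rfl
  obtain ⟨E, hE⟩ := g.exists_frame hφ hy
  -- Both alternatives enter only through this form of the Ricci tensor; a test field has `s = 0`.
  obtain ⟨r, s, hric⟩ : ∃ r s : ℝ, ∀ a b, ricci (g.comp φ) a b y =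
      r * g.comp φ a b y + s * emTensor (g.comp φ) (F.comp φ) a b y := by
    rcases hField with h | h
    · exact ⟨Λ, κ, hg.ricci_of_einsteinMaxwell hy hE (h φ hφ y hy)⟩
    · exact ⟨Λ, 0, fun a b => by rw [h φ hφ y hy a b]; ring⟩
  have hH := fun x hx => hg.chevretonTrace_eq (y := x) hx (F.comp φ)
  have hzero := hg.div2_traceFreeOuter hy hE hF hanti hdiv hcyc hric
  have hsm := hg.smooth_chevreton hF
  refine ⟨fun a b => ?_, ?_, fun b => ?_, fun b => ?_, fun c => ?_, fun d => ?_⟩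
  · rw [hH y hy, hH y hy, hg.traceFreeOuter_symm hy]
  · simp only [hH y hy, hg.trace_traceFreeOuter hy]
  · rw [← hzero b]
    simp only [div2, nabla2_congr (g.comp φ) hU hH hy]
  · rw [hg.trace34_div4 hsm hy (fun x hx => hg.trace34_chevreton hx (F.comp φ)), hzero]
  · refine (hg.trace24_div4 hsm hy (H := traceFreeOuter (g.comp φ) _)
      (fun x hx a c => ?_) c).trans (hzero c)
    -- Symmetry of `H_{abcd}` in its last pair turns the contraction over `b, d` into the one over
    -- adjacent indices.
    simp only [hg.chevreton_swap_right hx (F.comp φ) a _ c]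
    exact hg.trace23_chevreton hx (hA x hx) (hcyc x hx) (htr x hx) a c
  · exact (hg.trace23_div4 hsm hy (fun x hx => hg.trace23_chevreton hx (hA x hx) (hcyc x hx)
      (htr x hx)) d).trans (hzero d)
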